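/- Let $d>-1$, $d\neq 0$, and write $\lg=\log_2$. For a probability mass function $p=(p_1,\dots,p_n)$ with every $p_i\in(0,1)$ (hence $n\ge 2$), and the codeword lengths $l=(l_1,\dots,l_n)$ of a binary prefix code, the exponential redundancy is $R^d(p,l)=\frac1d\lg\sum_i p_i^{1+d}2^{d l_i}$. Let $R^d_{\mathrm{opt}}(p)$ be its minimum over all binary prefix codes for the $n$ symbols; this minimum is attained. For $x\in(0,1)$ put $$\omega^d(x)=\min_{\lambda\in\mathbb Z^+}\left(\lambda+\frac1d\lg\left(x^{1+d}+\frac{2^d(1-x)^{1+d}}{(2^\lambda-1)^d}\right)\right),\qquad o^d(x)=\min_{\mu\in\mathbb Z^+}\left(\mu+\frac1d\lg\left(x^{1+d}+\frac{(1-x)^{1+d}}{(2^\mu-1)^d}\right)\right).$$ Then the following hold. (1) Both minima are attained. For $\lambda\in\mathbb Z^+$ let $$a_\lambda=\left(1+\left((1-2^{-d})\left(\tfrac1{(2^\lambda-1)^d}-\tfrac1{(2^\lambda-0.5)^d}\right)^{-1}\right)^{\frac1{1+d}}\right)^{-1},$$ and for $\mu\in\mathbb Z^+$ let $$b_\mu=\left(1+\left((2^d-1)\left(\tfrac1{(2^\mu-1)^d}-\tfrac1{(2^\mu-0.5)^d}\right)^{-1}\right)^{\frac1{1+d}}\right)^{-1}.$$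 Both sequences are strictly decreasing with values in $(0,1)$. The minimum defining $\omega^d(x)$ changes from $\lambda$ to $\lambda+1$ at $a_\lambda$, that is, the minimizing $\lambda$ are exactly those with $a_\lambda\le x$ and, if $\lambda\ge2$, $x\le a_{\lambda-1}$. In the same way the minimum defining $o^d(x)$ changes from $\mu$ to $\mu+1$ at $b_\mu$. (2) For every such $p$ and every $j$, $\;0\le o^d(p_j)\le R^d_{\mathrm{opt}}(p)<\omega^d(p_j)\le 1$. (3) The lower bound is achieved by the most probable symbol: for every $x\in(0,1)$ there is such a $p$ with $p_1\ge p_2\ge\dots\ge p_n$, $p_1=x$ and $R^d_{\mathrm{opt}}(p)=o^d(x)$. (4) The upper bound is approached when $p_1\ge\frac12$: for every $x\in[\frac12,1)$ and every $\varepsilon>0$ there is such a $p$ with $p_1\ge p_2\ge\dots\ge p_n$, $p_1=x$ and $R^d_{\mathrm{opt}}(p)>\omega^d(x)-\varepsilon$. (5) If $d<0$, then for every such $p$ and every $j$ with $p_j<\frac12$, $$R^d_{\mathrm{opt}}(p)<\max\left(0.5,\ \frac1d\lg\left(p_j^{1+d}4^d+(1-p_j)^{1+d}2^d\right)\right).$$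 -/

import Mathlib

/-- A probability mass function on `n` symbols, every probability lying in `(0,1)`
(so that in particular `2 ≤ n`). -/
def IsSource {n : ℕ} (p : Fin n → ℝ) : Prop :=
  (∀ i, 0 < p i ∧ p i < 1) ∧ ∑ i, p i = 1

/-- A binary prefix code: no codeword is a prefix of the codeword of another symbol. -/
def IsPrefixCode {n : ℕ} (c : Fin n → List Bool) : Prop :=
  ∀ i k, i ≠ k → ¬ (c i <+: c k)

/-- Exponential redundancy of the codeword lengths `l`:
`(1/d) lg ∑ i, p i ^ (1+d) 2 ^ (d l i)`. -/
noncomputable def expRedundancy {n : ℕ} (d : ℝ) (p : Fin n → ℝ) (l : Fin n → ℕ) : ℝ :=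
  1 / d * Real.logb 2 (∑ i, p i ^ (1 + d) * (2 : ℝ) ^ (d * (l i : ℝ)))

/-- The values of the exponential redundancy over all binary prefix codes. -/
def redundancyValues {n : ℕ} (d : ℝ) (p : Fin n → ℝ) : Set ℝ :=
  {r | ∃ c : Fin n → List Bool, IsPrefixCode c ∧ r = expRedundancy d p (fun i => (c i).length)}

/-- The optimal exponential redundancy. -/
noncomputable def optRedundancy {n : ℕ} (d : ℝ) (p : Fin n → ℝ) : ℝ :=
  sInf (redundancyValues d p)

/-- The expression minimized in the upper bound. -/
noncomputable def upperTerm (d x : ℝ) (m : ℕ+) : ℝ :=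
  (m : ℝ) + 1 / d * Real.logb 2
    (x ^ (1 + d) + (2 : ℝ) ^ d * (1 - x) ^ (1 + d) / ((2 : ℝ) ^ (m : ℕ) - 1) ^ d)

/-- The upper bound `ω^d(x)`. -/
noncomputable def upperBound (d x : ℝ) : ℝ :=
  ⨅ m : ℕ+, upperTerm d x m

/-- The point of transition between `m` and `m + 1` in the upper bound. -/
noncomputable def upperTransition (d : ℝ) (m : ℕ+) : ℝ :=
  (1 + ((1 - (2 : ℝ) ^ (-d)) *
    (1 / ((2 : ℝ) ^ (m : ℕ) - 1) ^ d - 1 / ((2 : ℝ) ^ (m : ℕ) - 1 / 2) ^ d)⁻¹) ^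
      (1 / (1 + d)))⁻¹

/-- The expression minimized in the lower bound. -/
noncomputable def lowerTerm (d x : ℝ) (m : ℕ+) : ℝ :=
  (m : ℝ) + 1 / d * Real.logb 2
    (x ^ (1 + d) + (1 - x) ^ (1 + d) / ((2 : ℝ) ^ (m : ℕ) - 1) ^ d)

/-- The lower bound `o^d(x)`. -/
noncomputable def lowerBound (d x : ℝ) : ℝ :=
  ⨅ m : ℕ+, lowerTerm d x m

/-- The point of transition between `m` and `m + 1` in the lower bound. -/
noncomputable def lowerTransition (d : ℝ) (m : ℕ+) : ℝ :=
  (1 + (((2 : ℝ) ^ d - 1) *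
    (1 / ((2 : ℝ) ^ (m : ℕ) - 1) ^ d - 1 / ((2 : ℝ) ^ (m : ℕ) - 1 / 2) ^ d)⁻¹) ^
      (1 / (1 + d)))⁻¹

/-- `t m` are the transition points of the family `F · m`, with pointwise minimum `G`: they
decrease strictly inside `(0,1)`, and the indices minimizing `F x` are exactly the `m` with
`t m ≤ x ≤ t (m - 1)` (only `t 1 ≤ x` for `m = 1`). -/
def HasTransitions (F : ℝ → ℕ+ → ℝ) (G : ℝ → ℝ) (t : ℕ+ → ℝ) : Prop :=
  (∀ m, 0 < t m ∧ t m < 1) ∧ (∀ m, t (m + 1) < t m) ∧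
  ∀ x, 0 < x → x < 1 → ∀ m,
    (F x m = G x ↔ t m ≤ x ∧ ∀ k, k + 1 = m → x ≤ t k)

/-! By Kraft's inequality and its converse, a code may be replaced by its Kraft masses `r i = 2^(-l
i)`, and the redundancy becomes `(1/d) lg ∑ p i ^ (1+d) * r i ^ (-d)`. Each summand is `r *
(p/r)^(1+d)`, so Jensen merges all symbols except `j` into one symbol of probability `1 - p j` with
Kraft budget `1 - 2^(-m)`, where `m` is the length of the word for `j`. This is the lower bound
(`lowerTerm_le_expRedundancy`). It is attained when the other symbols are equiprobable and fill the
budget exactly.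

For the upper bound, `j` gets length `m` and the others a Shannon code scaled to the remaining
budget. Rounding costs them less than one bit, hence the extra factor `2^d`
(`optRedundancy_lt_upperTerm`). For `x ≥ 1/2`, splitting `1 - x` very unevenly in two forces this
whole bit to be lost in the limit.

Both bounds belong to one family `boundTerm d κ`, with `κ = 1` or `2^d`. Comparing consecutive terms
amounts to comparing `(x/(1-x))^(1+d)` with `κ * oddsThreshold d m`. The thresholds decrease
strictly to `0`, so the family is unimodal in `m` and its minimizers can be read off
(`boundTerm_cmp_succ`, `le_of_unimodal`).

For `d < 0` the secondary bound has two cases. If some `p i ≥ 1/2`, the upper term with `m = 1` at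
`i` is largest at an end of `[1/2, 1 - p j]`, by concavity. Otherwise the exponential redundancy is
at most the linear one, and a Gallager-type rounding argument keeps that below `1/2`
(`exists_linear_redundancy_lt_half`). -/

/-! ### Kraft's inequality and its converse -/

theorem uniquelyDecodable_of_prefixFree {α : Type*} {S : Set (List α)} (h0 : [] ∉ S)
    (h : ∀ u ∈ S, ∀ v ∈ S, u <+: v → u = v) : InformationTheory.UniquelyDecodable S := by
  intro L₁
  induction L₁ with
  | nil =>
    intro L₂ _ h₂ he
    rcases L₂ with _ | ⟨v, L₂⟩
    · rfl
    · have hv : v = [] := by simp at he; exact he.1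
      exact absurd (hv ▸ h₂ v (by simp)) h0
  | cons u L₁ ih =>
    intro L₂ h₁ h₂ he
    rcases L₂ with _ | ⟨v, L₂⟩
    · have hu : u = [] := by simp at he; exact he.1
      exact absurd (hu ▸ h₁ u (by simp)) h0
    · have hu := h₁ u (by simp)
      have hv := h₂ v (by simp)
      simp only [List.flatten_cons] at he
      have huv : u = v := by
        rcases List.prefix_or_prefix_of_prefix (List.prefix_append u L₁.flatten)
          (he ▸ List.prefix_append v L₂.flatten) with h' | h'
        · exact h u hu v hv h'
        · exact (h v hv u hu h').symm
      subst huv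
      rw [ih L₂ (fun w hw => h₁ w (by simp [hw])) (fun w hw => h₂ w (by simp [hw]))
        (List.append_cancel_left he)]

/-- The empty word alone is prefix-free but not uniquely decodable; a second symbol excludes it.
Positivity also turns lengths into indices in `ℕ+`. -/
theorem IsPrefixCode.length_pos {n : ℕ} (hn : 2 ≤ n) {c : Fin n → List Bool}
    (hc : IsPrefixCode c) (i : Fin n) : 0 < (c i).length := by
  have : Nontrivial (Fin n) := Fin.nontrivial_iff_two_le.2 hn
  obtain ⟨k, hk⟩ := exists_ne i
  rw [List.length_pos_iff]
  intro h
  exact hc i k hk.symm (h ▸ List.nil_prefix)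

/-- **Kraft's inequality** for binary prefix codes. -/
theorem IsPrefixCode.kraft_le_one {n : ℕ} (hn : 2 ≤ n) {c : Fin n → List Bool}
    (hc : IsPrefixCode c) : ∑ i, (1 / 2 : ℝ) ^ (c i).length ≤ 1 := by
  have hinj : Function.Injective c := by
    intro i k h
    by_contra hik
    exact hc i k hik (h ▸ List.prefix_rfl)
  have hud : InformationTheory.UniquelyDecodable
      ((Finset.univ.image c : Finset (List Bool)) : Set (List Bool)) := by
    apply uniquelyDecodable_of_prefixFree
    · simp only [Finset.coe_image, Finset.coe_univ, Set.image_univ, Set.mem_range, not_exists]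
      intro i hi
      have := hc.length_pos hn i
      simp [hi] at this
    · simp only [Finset.coe_image, Finset.coe_univ, Set.image_univ, Set.mem_range]
      rintro _ ⟨i, rfl⟩ _ ⟨k, rfl⟩ h
      by_contra hne
      exact hc i k (fun h => hne (h ▸ rfl)) h
  have := InformationTheory.kraft_mcmillan_inequality hud
  rw [Finset.sum_image (fun i _ k _ h => hinj h)] at this
  simpa using this

/-- The binary words of length `L`. -/
def binaryWords (L : ℕ) : Finset (List Bool) :=
  (Finset.univ : Finset (Fin L → Bool)).image List.ofFn

theorem mem_binaryWords {L : ℕ} {w : List Bool} : w ∈ binaryWords L ↔ w.length = L := by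
  simp only [binaryWords, Finset.mem_image, Finset.mem_univ, true_and]
  constructor
  · rintro ⟨f, rfl⟩; simp
  · rintro rfl; exact ⟨w.get, List.ofFn_get w⟩

theorem card_binaryWords (L : ℕ) : (binaryWords L).card = 2 ^ L := by
  rw [binaryWords, Finset.card_image_of_injective _ List.ofFn_injective]
  simp

/-- Words are chosen in order of increasing length, so a conflict arises only if the new word
extends an old one. The old word `c i` rules out `2^(l a - l i)` candidates, and Kraft leaves at
least one candidate free. -/
theorem exists_prefixFree_of_kraft {ι : Type*} [DecidableEq ι] (l : ι → ℕ) (s : Finset ι) :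
    ∑ i ∈ s, (1 / 2 : ℝ) ^ l i ≤ 1 →
    ∃ c : ι → List Bool, (∀ i ∈ s, (c i).length = l i) ∧
      ∀ i ∈ s, ∀ k ∈ s, i ≠ k → ¬ (c i <+: c k) := by
  induction s using Finset.induction_on_max_value l with
  | empty => intro _; exact ⟨fun _ => [], by simp, by simp⟩
  | insert a s has hmax ih =>
    intro hK
    rw [Finset.sum_insert has] at hK
    have hpa : (0 : ℝ) < (1 / 2 : ℝ) ^ l a := by positivity
    obtain ⟨c, hlen, hpre⟩ := ih (by linarith)
    let bad : Finset (List Bool) :=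
      s.biUnion fun i => (binaryWords (l a - l i)).image (c i ++ ·)
    have hcard : (bad.card : ℝ) < 2 ^ l a := by
      calc (bad.card : ℝ) ≤ ∑ i ∈ s, (2 : ℝ) ^ (l a - l i) := by
            have h1 : bad.card ≤ ∑ i ∈ s, 2 ^ (l a - l i) := by
              refine Finset.card_biUnion_le.trans (Finset.sum_le_sum fun i _ => ?_)
              exact Finset.card_image_le.trans (card_binaryWords _).le
            exact_mod_cast h1
        _ = 2 ^ l a * ∑ i ∈ s, (1 / 2 : ℝ) ^ l i := by
            rw [Finset.mul_sum]
            refine Finset.sum_congr rfl fun i hi => ?_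
            rw [pow_sub₀ _ two_ne_zero (hmax i hi), one_div, inv_pow]
        _ < 2 ^ l a * 1 := by
            apply mul_lt_mul_of_pos_left _ (by positivity)
            linarith
        _ = 2 ^ l a := mul_one _
    obtain ⟨w, hw, hwb⟩ : ∃ w ∈ binaryWords (l a), w ∉ bad := by
      apply Finset.exists_mem_notMem_of_card_lt_card
      rw [card_binaryWords]
      exact_mod_cast hcard
    rw [mem_binaryWords] at hw
    have hnp : ∀ i ∈ s, ¬ (c i <+: w) := by
      rintro i hi ⟨v, rfl⟩
      apply hwb
      simp only [bad, Finset.mem_biUnion, Finset.mem_image]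
      refine ⟨i, hi, v, ?_, rfl⟩
      rw [mem_binaryWords]
      simp only [List.length_append, hlen i hi] at hw
      omega
    have hne : ∀ i ∈ s, i ≠ a := fun i hi h => has (h ▸ hi)
    refine ⟨Function.update c a w, ?_, ?_⟩
    · intro i hi
      rcases Finset.mem_insert.1 hi with rfl | hi
      · simpa using hw
      · rw [Function.update_of_ne (hne i hi)]; exact hlen i hi
    · intro i hi k hk hik
      rcases Finset.mem_insert.1 hi with rfl | hi
      · rcases Finset.mem_insert.1 hk with rfl | hk
        · exact absurd rfl hik
        · rw [Function.update_self, Function.update_of_ne (hne k hk)]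
          intro h
          have : w = c k := h.eq_of_length_le (by rw [hlen k hk, hw]; exact hmax k hk)
          exact hnp k hk (this ▸ List.prefix_rfl)
      · rw [Function.update_of_ne (hne i hi)]
        rcases Finset.mem_insert.1 hk with hk | hk
        · rw [hk, Function.update_self]; exact hnp i hi
        · rw [Function.update_of_ne (hne k hk)]; exact hpre i hi k hk hik

/-- Converse of Kraft's inequality. -/
theorem exists_isPrefixCode_of_kraft {n : ℕ} (l : Fin n → ℕ)
    (h : ∑ i, (1 / 2 : ℝ) ^ l i ≤ 1) :
    ∃ c : Fin n → List Bool, IsPrefixCode c ∧ (fun i => (c i).length) = l := by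
  obtain ⟨c, hlen, hpre⟩ := exists_prefixFree_of_kraft l Finset.univ h
  exact ⟨c, fun i k hik => hpre i (Finset.mem_univ _) k (Finset.mem_univ _) hik,
    funext fun i => hlen i (Finset.mem_univ _)⟩

/-! ### Kraft masses and scaled logarithms -/

theorem half_pow_mul_two (d : ℝ) (l : ℕ) :
    (2 : ℝ) ^ (d * (l : ℝ)) = ((1 / 2 : ℝ) ^ l) ^ (-d) := by
  rw [one_div, inv_pow, Real.inv_rpow (by positivity), ← Real.rpow_neg (by positivity), neg_neg,
    ← Real.rpow_natCast, ← Real.rpow_mul (by norm_num), mul_comm]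

/-- The sign of `1/d` decides the direction of monotonicity; this is where the two sign cases of
later estimates come from. -/
theorem scaledLog_le {d a b : ℝ} (hd0 : d ≠ 0) (ha : 0 < a) (hb : 0 < b)
    (h1 : 0 < d → a ≤ b) (h2 : d < 0 → b ≤ a) :
    1 / d * Real.logb 2 a ≤ 1 / d * Real.logb 2 b := by
  rcases lt_or_gt_of_ne hd0 with hd | hd
  · exact mul_le_mul_of_nonpos_left (Real.logb_le_logb_of_le one_lt_two hb (h2 hd))
      (one_div_neg.2 hd).le
  · exact mul_le_mul_of_nonneg_left (Real.logb_le_logb_of_le one_lt_two ha (h1 hd))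
      (one_div_pos.2 hd).le

theorem scaledLog_lt {d a b : ℝ} (hd0 : d ≠ 0) (ha : 0 < a) (hb : 0 < b)
    (h1 : 0 < d → a < b) (h2 : d < 0 → b < a) :
    1 / d * Real.logb 2 a < 1 / d * Real.logb 2 b := by
  rcases lt_or_gt_of_ne hd0 with hd | hd
  · exact mul_lt_mul_of_neg_left (Real.logb_lt_logb one_lt_two hb (h2 hd)) (one_div_neg.2 hd)
  · exact mul_lt_mul_of_pos_left (Real.logb_lt_logb one_lt_two ha (h1 hd)) (one_div_pos.2 hd)

theorem scaledLog_le_iff {d a b : ℝ} (hd0 : d ≠ 0) (ha : 0 < a) (hb : 0 < b) :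
    1 / d * Real.logb 2 a ≤ 1 / d * Real.logb 2 b ↔ 0 ≤ d * (b - a) := by
  rcases lt_or_gt_of_ne hd0 with hd | hd
  · rw [mul_le_mul_left_of_neg (one_div_neg.2 hd), Real.logb_le_logb one_lt_two hb ha]
    constructor
    · intro h; nlinarith
    · intro h; by_contra! h'; nlinarith
  · rw [mul_le_mul_iff_right₀ (one_div_pos.2 hd), Real.logb_le_logb one_lt_two ha hb]
    constructor
    · intro h; nlinarith
    · intro h; by_contra! h'; nlinarith

theorem add_scaledLog {d s y : ℝ} (hd0 : d ≠ 0) (hy : 0 < y) :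
    s + 1 / d * Real.logb 2 y = 1 / d * Real.logb 2 ((2 : ℝ) ^ (d * s) * y) := by
  rw [Real.logb_mul (by positivity) hy.ne', Real.logb_rpow (by norm_num) (by norm_num)]
  field_simp

/-! ### The odds thresholds -/

theorem two_pow_sub_one_pos (m : ℕ+) : (0 : ℝ) < 2 ^ (m : ℕ) - 1 := by
  have : (1 : ℝ) < 2 ^ (m : ℕ) := one_lt_pow₀ one_lt_two m.ne_zero
  linarith

theorem mul_two_rpow_sub_one_pos {d : ℝ} (hd0 : d ≠ 0) : 0 < d / ((2 : ℝ) ^ d - 1) := by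
  rcases lt_or_gt_of_ne hd0 with hd | hd
  · exact div_pos_of_neg_of_neg hd
      (by linarith [Real.rpow_lt_one_of_one_lt_of_neg (x := 2) (by norm_num) hd])
  · exact div_pos hd (by linarith [Real.one_lt_rpow (x := 2) (by norm_num) hd])

/-- The odds raised to the power `1 + d` at which the lower bound changes from `m` to `m + 1`. -/
noncomputable def oddsThreshold (d : ℝ) (m : ℕ+) : ℝ :=
  (1 / ((2 : ℝ) ^ (m : ℕ) - 1) ^ d - 1 / ((2 : ℝ) ^ (m : ℕ) - 1 / 2) ^ d) / ((2 : ℝ) ^ d - 1)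

/-- Mean value theorem for `z^(-d)` on an interval of length `1/2`. The intervals for successive `m`
are disjoint and move to infinity, so sign, monotonicity and limit of the thresholds all follow from
those of `ξ^(-(1+d))`. -/
theorem oddsThreshold_eq {d : ℝ} (m : ℕ+) :
    ∃ ξ : ℝ, (2 : ℝ) ^ (m : ℕ) - 1 < ξ ∧ ξ < (2 : ℝ) ^ (m : ℕ) - 1 / 2 ∧
      oddsThreshold d m = d / ((2 : ℝ) ^ d - 1) * (ξ ^ (-(1 + d)) / 2) := by
  have hm := two_pow_sub_one_pos m
  obtain ⟨ξ, hξ, h⟩ := exists_hasDerivAt_eq_slope (fun z : ℝ => z ^ (-d))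
    (fun z => -d * z ^ (-d - 1)) (a := (2 : ℝ) ^ (m : ℕ) - 1) (b := (2 : ℝ) ^ (m : ℕ) - 1 / 2)
    (by linarith)
    (fun z hz => (Real.continuousAt_rpow_const _ _
      (Or.inl (by linarith [hz.1]))).continuousWithinAt)
    (fun z hz => Real.hasDerivAt_rpow_const (Or.inl (by linarith [hz.1])))
  refine ⟨ξ, hξ.1, hξ.2, ?_⟩
  have e : (2 : ℝ) ^ (m : ℕ) - 1 / 2 - (2 ^ (m : ℕ) - 1) = 1 / 2 := by ring
  rw [e] at h
  rw [oddsThreshold, one_div, one_div, ← Real.rpow_neg (by linarith),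
    ← Real.rpow_neg (by linarith), show -(1 + d) = -d - 1 by ring]
  have h' : (2 ^ (m : ℕ) - 1 : ℝ) ^ (-d) - (2 ^ (m : ℕ) - 1 / 2 : ℝ) ^ (-d)
      = d * ξ ^ (-d - 1) / 2 := by
    have := h
    field_simp at this
    linarith
  rw [h']
  ring

theorem oddsThreshold_pos {d : ℝ} (hd0 : d ≠ 0) (m : ℕ+) : 0 < oddsThreshold d m := by
  obtain ⟨ξ, h1, _, h⟩ := oddsThreshold_eq (d := d) m
  have hξ : 0 < ξ := (two_pow_sub_one_pos m).trans h1
  have := mul_two_rpow_sub_one_pos hd0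
  rw [h]
  positivity

theorem oddsThreshold_succ_lt {d : ℝ} (hd : -1 < d) (hd0 : d ≠ 0) (m : ℕ+) :
    oddsThreshold d (m + 1) < oddsThreshold d m := by
  obtain ⟨ξ, h1, h2, h⟩ := oddsThreshold_eq (d := d) m
  obtain ⟨η, g1, _, g⟩ := oddsThreshold_eq (d := d) (m + 1)
  have hξ : 0 < ξ := (two_pow_sub_one_pos m).trans h1
  have hlt : ξ < η := by
    have := two_pow_sub_one_pos m
    push_cast [pow_succ] at g1
    linarith
  rw [h, g]
  have := mul_two_rpow_sub_one_pos hd0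
  have := Real.rpow_lt_rpow_of_neg (z := -(1 + d)) hξ hlt (by linarith)
  gcongr

theorem tendsto_oddsThreshold {d : ℝ} (hd : -1 < d) (hd0 : d ≠ 0) :
    Filter.Tendsto (oddsThreshold d) Filter.atTop (nhds 0) := by
  have hc := mul_two_rpow_sub_one_pos hd0
  have hpow : Filter.Tendsto (fun m : ℕ+ => (2 : ℝ) ^ (m : ℕ) - 1) Filter.atTop Filter.atTop := by
    apply Filter.tendsto_atTop_add_const_right
    exact (tendsto_pow_atTop_atTop_of_one_lt one_lt_two).comp tendsto_PNat_val_atTop_atTop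
  have h0 : Filter.Tendsto (fun m : ℕ+ => d / ((2 : ℝ) ^ d - 1) *
      (((2 : ℝ) ^ (m : ℕ) - 1) ^ (-(1 + d)) / 2)) Filter.atTop (nhds 0) := by
    have := (tendsto_rpow_neg_atTop (y := 1 + d) (by linarith)).comp hpow
    simpa using (this.div_const 2).const_mul (d / ((2 : ℝ) ^ d - 1))
  refine squeeze_zero (fun m => (oddsThreshold_pos hd0 m).le) (fun m => ?_) h0
  obtain ⟨ξ, h1, h2, h⟩ := oddsThreshold_eq (d := d) m
  rw [h]
  have := Real.rpow_le_rpow_of_nonpos (z := -(1 + d)) (two_pow_sub_one_pos m) h1.le (by linarith)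
  gcongr

/-! ### The common family of bounds and its minimizers -/

/-- The common form of the lower (`κ = 1`) and the upper (`κ = 2 ^ d`) family. -/
noncomputable def boundTerm (d κ x : ℝ) (m : ℕ+) : ℝ :=
  (m : ℝ) + 1 / d * Real.logb 2
    (x ^ (1 + d) + κ * (1 - x) ^ (1 + d) / ((2 : ℝ) ^ (m : ℕ) - 1) ^ d)

/-- The probability at which the odds raised to the power `1 + d` equal `κ D_m`. -/
noncomputable def boundTransition (d κ : ℝ) (m : ℕ+) : ℝ :=
  (1 + ((κ * oddsThreshold d m)⁻¹) ^ (1 / (1 + d)))⁻¹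

theorem boundTransition_pos {d κ : ℝ} (hd0 : d ≠ 0) (hκ : 0 < κ) (m : ℕ+) :
    0 < boundTransition d κ m := by
  have := oddsThreshold_pos hd0 m
  rw [boundTransition]
  positivity

theorem boundTransition_lt_one {d κ : ℝ} (hd0 : d ≠ 0) (hκ : 0 < κ) (m : ℕ+) :
    boundTransition d κ m < 1 := by
  have := oddsThreshold_pos hd0 m
  have : 0 < ((κ * oddsThreshold d m)⁻¹) ^ (1 / (1 + d)) := by positivity
  exact inv_lt_one_of_one_lt₀ (by linarith)

theorem boundTransition_succ_lt {d κ : ℝ} (hd : -1 < d) (hd0 : d ≠ 0) (hκ : 0 < κ) (m : ℕ+) :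
    boundTransition d κ (m + 1) < boundTransition d κ m := by
  have h1 := oddsThreshold_pos hd0 m
  have h2 := oddsThreshold_pos hd0 (m + 1)
  have h3 := oddsThreshold_succ_lt hd hd0 m
  have h4 : 0 < 1 / (1 + d) := one_div_pos.2 (by linarith)
  rw [boundTransition, boundTransition]
  apply inv_strictAnti₀ (by positivity)
  have : (κ * oddsThreshold d m)⁻¹ < (κ * oddsThreshold d (m + 1))⁻¹ :=
    inv_strictAnti₀ (by positivity) (by gcongr)
  have := Real.rpow_lt_rpow (by positivity) this h4
  linarith

theorem boundTransition_antitone {d κ : ℝ} (hd : -1 < d) (hd0 : d ≠ 0) (hκ : 0 < κ) :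
    Antitone (boundTransition d κ) := by
  intro a b hab
  induction b using PNat.recOn with
  | one => rw [le_antisymm hab one_le]
  | succ b ih =>
    rcases hab.lt_or_eq with h | rfl
    · exact (boundTransition_succ_lt hd hd0 hκ b).le.trans (ih (PNat.lt_add_one_iff.1 h))
    · rfl

theorem boundTransition_cmp {d κ x : ℝ} (hd : -1 < d) (hd0 : d ≠ 0) (hκ : 0 < κ)
    (hx0 : 0 < x) (hx1 : x < 1) (m : ℕ+) :
    (boundTransition d κ m ≤ x ↔ κ * oddsThreshold d m * (1 - x) ^ (1 + d) ≤ x ^ (1 + d)) ∧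
    (x ≤ boundTransition d κ m ↔ x ^ (1 + d) ≤ κ * oddsThreshold d m * (1 - x) ^ (1 + d)) := by
  have hD := oddsThreshold_pos hd0 m
  have h1 : 0 < 1 + d := by linarith
  have hy : 0 < 1 - x := by linarith
  set T := κ * oddsThreshold d m with hT
  have hTpos : 0 < T := by positivity
  set u := T⁻¹ ^ (1 / (1 + d)) with hu
  have hupos : 0 < u := by positivity
  have hu1 : u ^ (1 + d) = T⁻¹ := by
    rw [hu, ← Real.rpow_mul (by positivity), one_div_mul_cancel h1.ne', Real.rpow_one]
  have hxu : (x * u) ^ (1 + d) = x ^ (1 + d) / T := by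
    rw [Real.mul_rpow hx0.le hupos.le, hu1, div_eq_mul_inv]
  have hb : boundTransition d κ m = 1 / (1 + u) := by rw [boundTransition, ← hT, ← hu, one_div]
  constructor
  · have e1 : boundTransition d κ m ≤ x ↔ 1 - x ≤ x * u := by
      rw [hb, div_le_iff₀ (by positivity)]
      constructor <;> intro h <;> linarith
    rw [e1, ← Real.rpow_le_rpow_iff hy.le (by positivity) h1, hxu, le_div_iff₀ hTpos, mul_comm]
  · have e1 : x ≤ boundTransition d κ m ↔ x * u ≤ 1 - x := by
      rw [hb, le_div_iff₀ (by positivity)]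
      constructor <;> intro h <;> linarith
    rw [e1, ← Real.rpow_le_rpow_iff (by positivity) hy.le h1, hxu, div_le_iff₀ hTpos,
      mul_comm T]

/-- Since `2^(m+1) - 1 = 2 * (2^m - 1/2)`, both terms can be written with the same integer part `m`.
Their logarithm arguments then differ by `(2^d - 1) * (A - κ * oddsThreshold d m * B)`, and `d *
(2^d - 1) > 0` treats both signs of `d` at once. -/
theorem boundTerm_cmp_succ {d κ x : ℝ} (hd : -1 < d) (hd0 : d ≠ 0) (hκ : 0 < κ)
    (hx0 : 0 < x) (hx1 : x < 1) (m : ℕ+) :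
    (boundTerm d κ x m ≤ boundTerm d κ x (m + 1) ↔ boundTransition d κ m ≤ x) ∧
    (boundTerm d κ x (m + 1) ≤ boundTerm d κ x m ↔ x ≤ boundTransition d κ m) := by
  have hm := two_pow_sub_one_pos m
  have hm' := two_pow_sub_one_pos (m + 1)
  have hy : 0 < 1 - x := by linarith
  obtain ⟨c1, c2⟩ := boundTransition_cmp hd hd0 hκ hx0 hx1 m
  rw [c1, c2]
  set A := x ^ (1 + d) with hA
  set B := (1 - x) ^ (1 + d) with hB
  have hApos : 0 < A := by positivity
  have hBpos : 0 < B := by positivity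
  have hk : (0 : ℝ) < 2 ^ (m : ℕ) - 1 / 2 := by linarith
  have hsplit : ((2 : ℝ) ^ ((m + 1 : ℕ+) : ℕ) - 1) ^ d
      = 2 ^ d * ((2 : ℝ) ^ (m : ℕ) - 1 / 2) ^ d := by
    rw [← Real.mul_rpow (by norm_num) hk.le]
    congr 1
    push_cast [pow_succ]
    ring
  have h2 : (0 : ℝ) < 2 ^ d := by positivity
  have e : boundTerm d κ x (m + 1) = (m : ℝ) + 1 / d * Real.logb 2
      ((2 : ℝ) ^ d * A + κ * B / ((2 : ℝ) ^ (m : ℕ) - 1 / 2) ^ d) := by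
    have : (2 : ℝ) ^ d * A + κ * B / ((2 : ℝ) ^ (m : ℕ) - 1 / 2) ^ d
        = (2 : ℝ) ^ (d * 1) * (A + κ * B / ((2 : ℝ) ^ ((m + 1 : ℕ+) : ℕ) - 1) ^ d) := by
      rw [hsplit, mul_one]
      field_simp
    rw [this, ← add_scaledLog hd0 (by positivity), boundTerm]
    push_cast
    ring
  have hD : κ * B / ((2 : ℝ) ^ (m : ℕ) - 1) ^ d - κ * B / ((2 : ℝ) ^ (m : ℕ) - 1 / 2) ^ d
      = (2 ^ d - 1) * (κ * oddsThreshold d m * B) := by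
    have hc : (2 : ℝ) ^ d - 1 ≠ 0 := by
      intro h
      have := mul_two_rpow_sub_one_pos hd0
      simp [h] at this
    rw [oddsThreshold]
    field_simp
  have hpos : 0 < d * ((2 : ℝ) ^ d - 1) := by
    have h := mul_two_rpow_sub_one_pos hd0
    rcases div_pos_iff.1 h with ⟨a, b⟩ | ⟨a, b⟩
    · exact mul_pos a b
    · exact mul_pos_of_neg_of_neg a b
  rw [e, boundTerm, add_le_add_iff_left, add_le_add_iff_left,
    scaledLog_le_iff hd0 (by positivity) (by positivity),
    scaledLog_le_iff hd0 (by positivity) (by positivity)]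
  constructor
  · rw [show d * (2 ^ d * A + κ * B / ((2 : ℝ) ^ (m : ℕ) - 1 / 2) ^ d -
        (A + κ * B / ((2 : ℝ) ^ (m : ℕ) - 1) ^ d)) =
        d * (2 ^ d - 1) * (A - κ * oddsThreshold d m * B) by linear_combination (-d) * hD,
      mul_nonneg_iff_of_pos_left hpos, sub_nonneg]
  · rw [show d * (A + κ * B / ((2 : ℝ) ^ (m : ℕ) - 1) ^ d -
        (2 ^ d * A + κ * B / ((2 : ℝ) ^ (m : ℕ) - 1 / 2) ^ d)) =
        d * (2 ^ d - 1) * (κ * oddsThreshold d m * B - A) by linear_combination d * hD,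
      mul_nonneg_iff_of_pos_left hpos, sub_nonneg]

/-- A sequence which rises after `m` and falls before `m` has its minimum at `m`. -/
theorem le_of_unimodal {f : ℕ+ → ℝ} {m : ℕ+} (hup : ∀ k, m ≤ k → f k ≤ f (k + 1))
    (hdown : ∀ k, k < m → f (k + 1) ≤ f k) (k : ℕ+) : f m ≤ f k := by
  have h1 : ∀ k, m ≤ k → f m ≤ f k := by
    intro k
    induction k using PNat.recOn with
    | one => intro h; rw [le_antisymm h one_le]
    | succ k ih =>
      intro h
      rcases h.lt_or_eq with h | rfl
      · exact (ih (PNat.lt_add_one_iff.1 h)).trans (hup k (PNat.lt_add_one_iff.1 h))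
      · rfl
  have h2 : ∀ j : ℕ+, j ≤ m → ∀ k, k ≤ j → f j ≤ f k := by
    intro j
    induction j using PNat.recOn with
    | one => intro _ k h; rw [le_antisymm h one_le]
    | succ j ih =>
      intro hj k h
      rcases h.lt_or_eq with h | rfl
      · exact (hdown j (PNat.add_one_le_iff.1 hj)).trans
          (ih ((PNat.lt_add_right j 1).le.trans hj) k (PNat.lt_add_one_iff.1 h))
      · rfl
  rcases le_total m k with h | h
  · exact h1 k h
  · exact h2 m le_rfl k h

theorem tendsto_boundTransition {d κ : ℝ} (hd : -1 < d) (hd0 : d ≠ 0) (hκ : 0 < κ) :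
    Filter.Tendsto (boundTransition d κ) Filter.atTop (nhds 0) := by
  have h0 : Filter.Tendsto (fun m => κ * oddsThreshold d m) Filter.atTop
      (nhdsWithin 0 (Set.Ioi 0)) := by
    apply tendsto_nhdsWithin_iff.2
    refine ⟨by simpa using (tendsto_oddsThreshold hd hd0).const_mul κ, ?_⟩
    exact Filter.Eventually.of_forall fun m => mul_pos hκ (oddsThreshold_pos hd0 m)
  have h1 := (tendsto_rpow_atTop (y := 1 / (1 + d)) (one_div_pos.2 (by linarith))).comp
    h0.inv_tendsto_nhdsGT_zero
  exact (Filter.tendsto_atTop_add_const_left _ 1 h1).inv_tendsto_atTop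

theorem boundTerm_isLeast_of_transition {d κ x : ℝ} (hd : -1 < d) (hd0 : d ≠ 0) (hκ : 0 < κ)
    (hx0 : 0 < x) (hx1 : x < 1) {m : ℕ+} (h1 : boundTransition d κ m ≤ x)
    (h2 : ∀ k, k + 1 = m → x ≤ boundTransition d κ k) (k : ℕ+) :
    boundTerm d κ x m ≤ boundTerm d κ x k := by
  have hanti := boundTransition_antitone hd hd0 hκ
  apply le_of_unimodal
  · intro k hk
    exact (boundTerm_cmp_succ hd hd0 hκ hx0 hx1 k).1.2 ((hanti hk).trans h1)
  · intro k hk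
    obtain ⟨j, rfl⟩ := PNat.exists_eq_succ_of_ne_one (ne_of_gt (lt_of_le_of_lt one_le hk) : m ≠ 1)
    exact (boundTerm_cmp_succ hd hd0 hκ hx0 hx1 k).2.2
      ((h2 j rfl).trans (hanti (PNat.lt_add_one_iff.1 hk)))

theorem boundTerm_isLeast {d κ x : ℝ} (hd : -1 < d) (hd0 : d ≠ 0) (hκ : 0 < κ)
    (hx0 : 0 < x) (hx1 : x < 1) :
    IsLeast (Set.range (boundTerm d κ x)) (⨅ m, boundTerm d κ x m) := by
  obtain ⟨m, hm⟩ := ((tendsto_boundTransition hd hd0 hκ).eventually_lt_const hx0).exists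
  -- The least index whose transition point is at most `x` is a minimizer; one exists because the
  -- transition points tend to `0`.
  obtain ⟨m, hm, hmin⟩ := WellFounded.has_min (wellFounded_lt (α := ℕ+))
    {m | boundTransition d κ m ≤ x} ⟨m, hm.le⟩
  have h : IsLeast (Set.range (boundTerm d κ x)) (boundTerm d κ x m) := by
    refine ⟨⟨m, rfl⟩, ?_⟩
    rintro _ ⟨k, rfl⟩
    refine boundTerm_isLeast_of_transition hd hd0 hκ hx0 hx1 hm (fun j hj => ?_) k
    by_contra! hlt
    exact hmin j hlt.le (hj ▸ PNat.lt_add_right j 1)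
  rw [iInf, h.csInf_eq]
  exact h

theorem boundTerm_hasTransitions {d κ : ℝ} (hd : -1 < d) (hd0 : d ≠ 0) (hκ : 0 < κ) :
    HasTransitions (boundTerm d κ) (fun x => ⨅ m, boundTerm d κ x m) (boundTransition d κ) := by
  refine ⟨fun m => ⟨boundTransition_pos hd0 hκ m, boundTransition_lt_one hd0 hκ m⟩,
    boundTransition_succ_lt hd hd0 hκ, fun x hx0 hx1 m => ?_⟩
  have hL := boundTerm_isLeast hd hd0 hκ hx0 hx1
  constructor
  · intro h
    constructor
    · exact (boundTerm_cmp_succ hd hd0 hκ hx0 hx1 m).1.1 (h.le.trans (hL.2 ⟨_, rfl⟩))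
    · rintro k rfl
      exact (boundTerm_cmp_succ hd hd0 hκ hx0 hx1 k).2.1 (h.le.trans (hL.2 ⟨_, rfl⟩))
  · rintro ⟨h1, h2⟩
    obtain ⟨k, hk⟩ := hL.1
    refine le_antisymm ?_ (hL.2 ⟨m, rfl⟩)
    refine le_trans ?_ hk.le
    exact boundTerm_isLeast_of_transition hd hd0 hκ hx0 hx1 h1 h2 k

theorem lowerTerm_eq_boundTerm (d : ℝ) : lowerTerm d = boundTerm d 1 := by
  funext x m
  simp [lowerTerm, boundTerm]

theorem upperTerm_eq_boundTerm (d : ℝ) : upperTerm d = boundTerm d (2 ^ d) := rfl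

theorem lowerTransition_eq_boundTransition (d : ℝ) :
    lowerTransition d = boundTransition d 1 := by
  funext m
  rw [lowerTransition, boundTransition, oddsThreshold, one_mul, inv_div, ← div_eq_mul_inv]

theorem upperTransition_eq_boundTransition (d : ℝ) :
    upperTransition d = boundTransition d (2 ^ d) := by
  funext m
  have h2 : (2 : ℝ) ^ d ≠ 0 := by positivity
  rw [upperTransition, boundTransition, oddsThreshold, mul_inv, inv_div, ← div_eq_mul_inv,
    Real.rpow_neg (by norm_num)]
  congr 4
  field_simp

theorem lowerBound_eq_iInf (d : ℝ) : lowerBound d = fun x => ⨅ m, boundTerm d 1 x m := by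
  funext x
  rw [lowerBound, lowerTerm_eq_boundTerm]

theorem upperTerm_isLeast {d x : ℝ} (hd : -1 < d) (hd0 : d ≠ 0) (hx0 : 0 < x) (hx1 : x < 1) :
    IsLeast (Set.range (upperTerm d x)) (upperBound d x) :=
  boundTerm_isLeast hd hd0 (by positivity) hx0 hx1

theorem lowerTerm_isLeast {d x : ℝ} (hd : -1 < d) (hd0 : d ≠ 0) (hx0 : 0 < x) (hx1 : x < 1) :
    IsLeast (Set.range (lowerTerm d x)) (lowerBound d x) := by
  rw [lowerTerm_eq_boundTerm, lowerBound_eq_iInf]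
  exact boundTerm_isLeast hd hd0 one_pos hx0 hx1

theorem upperTerm_hasTransitions {d : ℝ} (hd : -1 < d) (hd0 : d ≠ 0) :
    HasTransitions (upperTerm d) (upperBound d) (upperTransition d) := by
  rw [upperTransition_eq_boundTransition]
  exact boundTerm_hasTransitions hd hd0 (by positivity)

theorem lowerTerm_hasTransitions {d : ℝ} (hd : -1 < d) (hd0 : d ≠ 0) :
    HasTransitions (lowerTerm d) (lowerBound d) (lowerTransition d) := by
  rw [lowerTransition_eq_boundTransition, lowerTerm_eq_boundTerm, lowerBound_eq_iInf]
  exact boundTerm_hasTransitions hd hd0 one_pos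

/-! ### Jensen's inequality and the lower bound -/

theorem rpow_mul_rpow_neg {d p r : ℝ} (hp : 0 ≤ p) (hr : 0 < r) :
    p ^ (1 + d) * r ^ (-d) = r * (p / r) ^ (1 + d) := by
  rw [Real.div_rpow hp hr.le, Real.rpow_add hr, Real.rpow_one, Real.rpow_neg hr.le]
  have := Real.rpow_pos_of_pos hr d
  field_simp

/-- Jensen for the convex power `1 + d` at the points `p i / r i` with weights proportional to `r
i`; enlarging the budget to `R` only lowers the left side. -/
theorem sum_rpow_mul_rpow_ge {ι : Type*} {s : Finset ι} {d R : ℝ} {p r : ι → ℝ} (hd : 0 < d)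
    (hs : s.Nonempty) (hp : ∀ i ∈ s, 0 < p i) (hr : ∀ i ∈ s, 0 < r i) (hR : ∑ i ∈ s, r i ≤ R) :
    (∑ i ∈ s, p i) ^ (1 + d) * R ^ (-d) ≤ ∑ i ∈ s, p i ^ (1 + d) * r i ^ (-d) := by
  have hS : 0 < ∑ i ∈ s, r i := Finset.sum_pos hr hs
  have hP : 0 < ∑ i ∈ s, p i := Finset.sum_pos hp hs
  have h := Real.rpow_arith_mean_le_arith_mean_rpow s (fun i => r i / ∑ k ∈ s, r k)
    (fun i => p i / r i) (fun i hi => (div_pos (hr i hi) hS).le)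
    (by rw [← Finset.sum_div, div_self hS.ne']) (fun i hi => (div_pos (hp i hi) (hr i hi)).le)
    (p := 1 + d) (by linarith)
  have e1 : ∑ i ∈ s, r i / (∑ k ∈ s, r k) * (p i / r i) = (∑ i ∈ s, p i) / ∑ k ∈ s, r k := by
    rw [Finset.sum_div]
    refine Finset.sum_congr rfl fun i hi => ?_
    have := hr i hi
    field_simp
  have e2 : ∑ i ∈ s, r i / (∑ k ∈ s, r k) * (p i / r i) ^ (1 + d)
      = (∑ i ∈ s, p i ^ (1 + d) * r i ^ (-d)) / ∑ k ∈ s, r k := by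
    rw [Finset.sum_div]
    refine Finset.sum_congr rfl fun i hi => ?_
    rw [rpow_mul_rpow_neg (hp i hi).le (hr i hi)]
    ring
  rw [e1, e2, le_div_iff₀ hS, mul_comm, ← rpow_mul_rpow_neg hP.le hS] at h
  refine le_trans ?_ h
  gcongr ?_ * ?_
  exact Real.rpow_le_rpow_of_nonpos hS hR (by linarith)

/-- The concave counterpart, as `0 < 1 + d < 1`. -/
theorem sum_rpow_mul_rpow_le {ι : Type*} {s : Finset ι} {d R : ℝ} {p r : ι → ℝ} (hd : -1 < d)
    (hd0 : d < 0) (hs : s.Nonempty) (hp : ∀ i ∈ s, 0 < p i) (hr : ∀ i ∈ s, 0 < r i)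
    (hR : ∑ i ∈ s, r i ≤ R) :
    ∑ i ∈ s, p i ^ (1 + d) * r i ^ (-d) ≤ (∑ i ∈ s, p i) ^ (1 + d) * R ^ (-d) := by
  have hS : 0 < ∑ i ∈ s, r i := Finset.sum_pos hr hs
  have hP : 0 < ∑ i ∈ s, p i := Finset.sum_pos hp hs
  have h := (Real.concaveOn_rpow (p := 1 + d) (by linarith) (by linarith)).le_map_sum (t := s)
    (w := fun i => r i / ∑ k ∈ s, r k)
    (p := fun i => p i / r i) (fun i hi => (div_pos (hr i hi) hS).le)
    (by rw [← Finset.sum_div, div_self hS.ne']) (fun i hi => (div_pos (hp i hi) (hr i hi)).le)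
  simp only [smul_eq_mul] at h
  have e1 : ∑ i ∈ s, r i / (∑ k ∈ s, r k) * (p i / r i) = (∑ i ∈ s, p i) / ∑ k ∈ s, r k := by
    rw [Finset.sum_div]
    refine Finset.sum_congr rfl fun i hi => ?_
    have := hr i hi
    field_simp
  have e2 : ∑ i ∈ s, r i / (∑ k ∈ s, r k) * (p i / r i) ^ (1 + d)
      = (∑ i ∈ s, p i ^ (1 + d) * r i ^ (-d)) / ∑ k ∈ s, r k := by
    rw [Finset.sum_div]
    refine Finset.sum_congr rfl fun i hi => ?_
    rw [rpow_mul_rpow_neg (hp i hi).le (hr i hi)]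
    ring
  rw [e1, e2, div_le_iff₀ hS, mul_comm _ (∑ k ∈ s, r k), ← rpow_mul_rpow_neg hP.le hS] at h
  refine h.trans ?_
  gcongr ?_ * ?_
  exact Real.rpow_le_rpow hS.le hR (by linarith)

theorem expRedundancy_eq {n : ℕ} (d : ℝ) (p : Fin n → ℝ) (l : Fin n → ℕ) :
    expRedundancy d p l =
      1 / d * Real.logb 2 (∑ i, p i ^ (1 + d) * ((1 / 2 : ℝ) ^ l i) ^ (-d)) := by
  simp only [expRedundancy, half_pow_mul_two]

theorem half_pow_lt_one (m : ℕ+) : (1 / 2 : ℝ) ^ (m : ℕ) < 1 :=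
  pow_lt_one₀ (by norm_num) (by norm_num) m.ne_zero

/-- For `κ = 1` this is the redundancy of a two-symbol source `(x, 1 - x)` with idealized Kraft
masses `2^(-m)` and `1 - 2^(-m)`; `κ = 2^d` charges one more bit to the second symbol. -/
theorem boundTerm_eq {d κ x : ℝ} (hd0 : d ≠ 0) (hκ : 0 < κ) (hx0 : 0 < x) (hx1 : x < 1)
    (m : ℕ+) :
    boundTerm d κ x m = 1 / d * Real.logb 2 (x ^ (1 + d) * ((1 / 2 : ℝ) ^ (m : ℕ)) ^ (-d) +
      κ * ((1 - x) ^ (1 + d) * (1 - (1 / 2 : ℝ) ^ (m : ℕ)) ^ (-d))) := by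
  have hm := two_pow_sub_one_pos m
  have hy : 0 < 1 - x := by linarith
  have h1 : (1 : ℝ) - (1 / 2) ^ (m : ℕ) = (1 / 2) ^ (m : ℕ) * (2 ^ (m : ℕ) - 1) := by
    rw [one_div, inv_pow]
    field_simp
  rw [boundTerm, add_scaledLog hd0 (by positivity), half_pow_mul_two, h1,
    Real.mul_rpow (by positivity) hm.le, Real.rpow_neg hm.le]
  congr 2
  field_simp

theorem IsSource.two_le {n : ℕ} {p : Fin n → ℝ} (hp : IsSource p) : 2 ≤ n := by
  obtain ⟨h, hs⟩ := hp
  match n, p, h, hs with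
  | 0, p, h, hs => simp at hs
  | 1, p, h, hs => simp at hs; linarith [(h 0).2]
  | n + 2, p, h, hs => omega

theorem IsSource.erase_nonempty {n : ℕ} {p : Fin n → ℝ} (hp : IsSource p) (j : Fin n) :
    (Finset.univ.erase j).Nonempty := by
  have : Nontrivial (Fin n) := Fin.nontrivial_iff_two_le.2 hp.two_le
  obtain ⟨k, hk⟩ := exists_ne j
  exact ⟨k, by simp [hk]⟩

theorem IsSource.sum_erase {n : ℕ} {p : Fin n → ℝ} (hp : IsSource p) (j : Fin n) :
    ∑ i ∈ Finset.univ.erase j, p i = 1 - p j := by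
  have := Finset.add_sum_erase Finset.univ p (Finset.mem_univ j)
  rw [hp.2] at this
  linarith

/-- With one codeword length fixed, the lower family bounds the redundancy of any code. -/
theorem lowerTerm_le_expRedundancy {n : ℕ} {d : ℝ} (hd : -1 < d) (hd0 : d ≠ 0) {p : Fin n → ℝ}
    (hp : IsSource p) {l : Fin n → ℕ} (hK : ∑ i, (1 / 2 : ℝ) ^ l i ≤ 1) (j : Fin n) (m : ℕ+)
    (hm : l j = m) : lowerTerm d (p j) m ≤ expRedundancy d p l := by
  have hx0 := (hp.1 j).1
  have hx1 := (hp.1 j).2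
  have hy : 0 < 1 - p j := by linarith
  have hq := half_pow_lt_one m
  have hq' : 0 < 1 - (1 / 2 : ℝ) ^ (m : ℕ) := by linarith
  have hs := hp.erase_nonempty j
  have hpp : ∀ i ∈ Finset.univ.erase j, 0 < p i := fun i _ => (hp.1 i).1
  have hrr : ∀ i ∈ Finset.univ.erase j, (0 : ℝ) < (1 / 2 : ℝ) ^ l i := fun i _ => by positivity
  have hR : ∑ i ∈ Finset.univ.erase j, (1 / 2 : ℝ) ^ l i ≤ 1 - (1 / 2 : ℝ) ^ (m : ℕ) := by
    have := Finset.add_sum_erase Finset.univ (fun i => (1 / 2 : ℝ) ^ l i) (Finset.mem_univ j)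
    simp only [hm] at this
    linarith
  rw [lowerTerm_eq_boundTerm, boundTerm_eq hd0 one_pos hx0 hx1, expRedundancy_eq,
    ← Finset.add_sum_erase _ _ (Finset.mem_univ j), hm, one_mul]
  have hpos : 0 < ∑ i ∈ Finset.univ.erase j, p i ^ (1 + d) * ((1 / 2 : ℝ) ^ l i) ^ (-d) :=
    Finset.sum_pos (fun i hi => by have := hpp i hi; positivity) hs
  refine scaledLog_le hd0 (by positivity) (by positivity) (fun h => ?_) (fun h => ?_)
  · have := sum_rpow_mul_rpow_ge h hs hpp hrr hR
    rw [hp.sum_erase] at this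
    linarith
  · have := sum_rpow_mul_rpow_le hd h hs hpp hrr hR
    rw [hp.sum_erase] at this
    linarith

/-- Jensen again, now merging the two idealized symbols into one of probability and budget `1`. -/
theorem lowerTerm_nonneg {d x : ℝ} (hd : -1 < d) (hd0 : d ≠ 0) (hx0 : 0 < x) (hx1 : x < 1)
    (m : ℕ+) : 0 ≤ lowerTerm d x m := by
  have hy : 0 < 1 - x := by linarith
  have hq := half_pow_lt_one m
  have hq0 : (0 : ℝ) < (1 / 2 : ℝ) ^ (m : ℕ) := by positivity
  have hq' : 0 < 1 - (1 / 2 : ℝ) ^ (m : ℕ) := by linarith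
  rw [lowerTerm_eq_boundTerm, boundTerm_eq hd0 one_pos hx0 hx1, one_mul]
  rw [show (0 : ℝ) = 1 / d * Real.logb 2 1 by simp]
  have hp : ∀ i ∈ (Finset.univ : Finset (Fin 2)), 0 < (![x, 1 - x] : Fin 2 → ℝ) i := by
    intro i _; fin_cases i <;> simp [hx0, hx1]
  have hr : ∀ i ∈ (Finset.univ : Finset (Fin 2)), 0 <
      (![(1 / 2 : ℝ) ^ (m : ℕ), 1 - (1 / 2 : ℝ) ^ (m : ℕ)] : Fin 2 → ℝ) i := by
    intro i _; fin_cases i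
    · exact hq0
    · exact hq'
  refine scaledLog_le hd0 one_pos (by positivity) (fun h => ?_) (fun h => ?_)
  · simpa [Fin.sum_univ_two] using sum_rpow_mul_rpow_ge (R := 1) h Finset.univ_nonempty hp hr
      (by simp [Fin.sum_univ_two])
  · simpa [Fin.sum_univ_two] using sum_rpow_mul_rpow_le (R := 1) hd h Finset.univ_nonempty hp hr
      (by simp [Fin.sum_univ_two])

/-! ### Existence of an optimal code -/

theorem expRedundancy_mono {n : ℕ} {d : ℝ} (hd0 : d ≠ 0) {p : Fin n → ℝ} (hp : IsSource p) :
    Monotone (expRedundancy d p) := by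
  intro l l' h
  have hne : (Finset.univ : Finset (Fin n)).Nonempty := by
    have := hp.two_le
    exact ⟨⟨0, by omega⟩, Finset.mem_univ _⟩
  have hpos : ∀ l : Fin n → ℕ, 0 < ∑ i, p i ^ (1 + d) * (2 : ℝ) ^ (d * (l i : ℝ)) := fun l =>
    Finset.sum_pos (fun i _ => by have := (hp.1 i).1; positivity) hne
  refine scaledLog_le hd0 (hpos l) (hpos l') (fun hd => ?_) (fun hd => ?_)
  · refine Finset.sum_le_sum fun i _ => ?_
    have := (hp.1 i).1
    gcongr
    · norm_num
    · exact_mod_cast h i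
  · refine Finset.sum_le_sum fun i _ => ?_
    have := (hp.1 i).1
    refine mul_le_mul_of_nonneg_left (Real.rpow_le_rpow_of_exponent_le (by norm_num) ?_)
      (by positivity)
    exact mul_le_mul_of_nonpos_left (by exact_mod_cast h i) hd.le

theorem redundancyValues_nonempty {n : ℕ} (d : ℝ) (p : Fin n → ℝ) :
    (redundancyValues d p).Nonempty := by
  obtain ⟨c, hc, -⟩ := exists_isPrefixCode_of_kraft (fun _ : Fin n => n) (by
    simp only [Finset.sum_const, Finset.card_univ, Fintype.card_fin, nsmul_eq_mul, one_div,
      inv_pow]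
    rw [mul_inv_le_iff₀ (by positivity), one_mul]
    exact_mod_cast Nat.lt_two_pow_self.le)
  exact ⟨_, c, hc, rfl⟩

/-- An optimal code exists: length vectors are partially well-ordered (Dickson) and the
redundancy is monotone in them. -/
theorem redundancyValues_isLeast {n : ℕ} {d : ℝ} (hd0 : d ≠ 0) {p : Fin n → ℝ}
    (hp : IsSource p) : IsLeast (redundancyValues d p) (optRedundancy d p) := by
  have himg : redundancyValues d p = expRedundancy d p ''
      {l | ∃ c : Fin n → List Bool, IsPrefixCode c ∧ l = fun i => (c i).length} := by
    ext r
    constructor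
    · rintro ⟨c, hc, rfl⟩; exact ⟨_, ⟨c, hc, rfl⟩, rfl⟩
    · rintro ⟨_, ⟨c, hc, rfl⟩, rfl⟩; exact ⟨c, hc, rfl⟩
  have hwf : (redundancyValues d p).IsWF := by
    rw [himg]
    exact ((Set.isPWO_of_wellQuasiOrderedLE _).image_of_monotone (expRedundancy_mono hd0 hp)).isWF
  have hne := redundancyValues_nonempty d p
  have h : IsLeast (redundancyValues d p) (hwf.min hne) :=
    ⟨hwf.min_mem hne, fun r hr => hwf.min_le hne hr⟩
  rw [optRedundancy, h.csInf_eq]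
  exact h

theorem optRedundancy_le {n : ℕ} {d : ℝ} (hd0 : d ≠ 0) {p : Fin n → ℝ} (hp : IsSource p)
    {l : Fin n → ℕ} (hK : ∑ i, (1 / 2 : ℝ) ^ l i ≤ 1) :
    optRedundancy d p ≤ expRedundancy d p l := by
  obtain ⟨c, hc, rfl⟩ := exists_isPrefixCode_of_kraft l hK
  exact (redundancyValues_isLeast hd0 hp).2 ⟨c, hc, rfl⟩

theorem le_optRedundancy {n : ℕ} {d a : ℝ} (hd0 : d ≠ 0) {p : Fin n → ℝ} (hp : IsSource p)
    (h : ∀ l : Fin n → ℕ, (∀ i, 0 < l i) → ∑ i, (1 / 2 : ℝ) ^ l i ≤ 1 → a ≤ expRedundancy d p l) :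
    a ≤ optRedundancy d p := by
  obtain ⟨c, hc, hr⟩ := (redundancyValues_isLeast hd0 hp).1
  rw [hr]
  exact h _ (hc.length_pos hp.two_le) (hc.kraft_le_one hp.two_le)

theorem lowerBound_nonneg {d x : ℝ} (hd : -1 < d) (hd0 : d ≠ 0) (hx0 : 0 < x) (hx1 : x < 1) :
    0 ≤ lowerBound d x := by
  obtain ⟨m, hm⟩ := (lowerTerm_isLeast hd hd0 hx0 hx1).1
  rw [← hm]
  exact lowerTerm_nonneg hd hd0 hx0 hx1 m

theorem lowerBound_le_optRedundancy {n : ℕ} {d : ℝ} (hd : -1 < d) (hd0 : d ≠ 0) {p : Fin n → ℝ}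
    (hp : IsSource p) (j : Fin n) : lowerBound d (p j) ≤ optRedundancy d p := by
  refine le_optRedundancy hd0 hp fun l hl hK => ?_
  exact ((lowerTerm_isLeast hd hd0 (hp.1 j).1 (hp.1 j).2).2 ⟨⟨l j, hl j⟩, rfl⟩).trans
    (lowerTerm_le_expRedundancy hd hd0 hp hK j ⟨l j, hl j⟩ rfl)

/-! ### The upper bound -/

theorem exists_half_pow_near {q : ℝ} (hq0 : 0 < q) (hq1 : q ≤ 1) :
    ∃ l : ℕ, (1 / 2 : ℝ) ^ l ≤ q ∧ q / 2 < (1 / 2 : ℝ) ^ l := by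
  obtain ⟨k, h1, h2⟩ := exists_nat_pow_near_of_lt_one hq0 hq1 (y := (1 / 2 : ℝ)) (by norm_num)
    (by norm_num)
  -- If `q` is itself a power of `1/2`, the exponent `k + 1` would give only equality in the second
  -- bound. Its strictness is what makes the upper bound on the redundancy strict.
  rcases h2.lt_or_eq with h | h
  · refine ⟨k + 1, h1.le, ?_⟩
    rw [pow_succ]; linarith
  · exact ⟨k, h.ge, by linarith⟩

theorem optRedundancy_lt_upperTerm {n : ℕ} {d : ℝ} (hd0 : d ≠ 0) {p : Fin n → ℝ}
    (hp : IsSource p) (j : Fin n) (m : ℕ+) : optRedundancy d p < upperTerm d (p j) m := by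
  have hx0 := (hp.1 j).1
  have hx1 := (hp.1 j).2
  have hy : 0 < 1 - p j := by linarith
  have hq := half_pow_lt_one m
  set q := (1 / 2 : ℝ) ^ (m : ℕ) with hqdef
  have hq0 : 0 < q := by positivity
  have hq' : 0 < 1 - q := by linarith
  -- The scaled probabilities `p i * θ` of the other symbols fill the budget `1 - q` exactly; their
  -- Shannon code is used.
  set θ := (1 - q) / (1 - p j) with hθ
  have hθ0 : 0 < θ := by positivity
  have hle : ∀ i, i ≠ j → p i * θ ≤ 1 := by
    intro i hi
    have : p i ≤ 1 - p j := by
      rw [← hp.sum_erase j]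
      exact Finset.single_le_sum (fun k _ => (hp.1 k).1.le) (by simp [hi])
    calc p i * θ ≤ (1 - p j) * θ := by gcongr
      _ = 1 - q := by rw [hθ]; field_simp
      _ ≤ 1 := by linarith
  have hl : ∀ i, ∃ k : ℕ, (i = j → k = m) ∧
      (i ≠ j → (1 / 2 : ℝ) ^ k ≤ p i * θ ∧ p i * θ / 2 < (1 / 2 : ℝ) ^ k) := by
    intro i
    by_cases hi : i = j
    · exact ⟨m, by simp [hi]⟩
    · obtain ⟨k, hk⟩ := exists_half_pow_near (mul_pos (hp.1 i).1 hθ0) (hle i hi)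
      exact ⟨k, by simp [hi], fun _ => hk⟩
  choose l hlj hli using hl
  have hsum : ∑ i ∈ Finset.univ.erase j, p i * θ = 1 - q := by
    rw [← Finset.sum_mul, hp.sum_erase, hθ]; field_simp
  have hK : ∑ i, (1 / 2 : ℝ) ^ l i ≤ 1 := by
    rw [← Finset.add_sum_erase _ _ (Finset.mem_univ j), hlj j rfl, ← hqdef]
    have : ∑ i ∈ Finset.univ.erase j, (1 / 2 : ℝ) ^ l i ≤ 1 - q := by
      rw [← hsum]
      exact Finset.sum_le_sum fun i hi => (hli i (Finset.ne_of_mem_erase hi)).1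
    linarith
  refine (optRedundancy_le hd0 hp hK).trans_lt ?_
  have hs := hp.erase_nonempty j
  have hpos : 0 < ∑ i ∈ Finset.univ.erase j, p i ^ (1 + d) * ((1 / 2 : ℝ) ^ l i) ^ (-d) :=
    Finset.sum_pos (fun i hi => by have := (hp.1 i).1; positivity) hs
  -- Masses proportional to `p i` are the equality case of Jensen, so the sum collapses; halving
  -- them, the worst rounding, produces the factor `2^d`.
  have hterm : ∑ i ∈ Finset.univ.erase j, p i ^ (1 + d) * (p i * θ / 2) ^ (-d) =
      2 ^ d * ((1 - p j) ^ (1 + d) * (1 - q) ^ (-d)) := by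
    have : ∀ i ∈ Finset.univ.erase j, p i ^ (1 + d) * (p i * θ / 2) ^ (-d)
        = p i * (θ / 2) ^ (-d) := by
      intro i _
      have hpi := (hp.1 i).1
      rw [mul_div_assoc, Real.mul_rpow hpi.le (by positivity), ← mul_assoc,
        ← Real.rpow_add hpi, add_neg_cancel_right, Real.rpow_one]
    rw [Finset.sum_congr rfl this, ← Finset.sum_mul, hp.sum_erase, hθ,
      Real.div_rpow (by positivity) (by norm_num), Real.div_rpow hq'.le hy.le,
      Real.rpow_add hy, Real.rpow_one, Real.rpow_neg hy.le, Real.rpow_neg (x := 2) (by norm_num)]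
    field_simp
  rw [upperTerm_eq_boundTerm, boundTerm_eq hd0 (by positivity) hx0 hx1, expRedundancy_eq,
    ← Finset.add_sum_erase _ _ (Finset.mem_univ j), hlj j rfl, ← hqdef, ← hterm]
  have hpos' : 0 < ∑ i ∈ Finset.univ.erase j, p i ^ (1 + d) * (p i * θ / 2) ^ (-d) := by
    rw [hterm]; positivity
  refine scaledLog_lt hd0 (by positivity) (by positivity) (fun h => ?_) (fun h => ?_)
  · refine (add_lt_add_iff_left _).2 (Finset.sum_lt_sum_of_nonempty hs fun i hi => ?_)
    have hpi := (hp.1 i).1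
    have := (hli i (Finset.ne_of_mem_erase hi)).2
    exact mul_lt_mul_of_pos_left (Real.rpow_lt_rpow_of_neg (by positivity) this (by linarith))
      (by positivity)
  · refine (add_lt_add_iff_left _).2 (Finset.sum_lt_sum_of_nonempty hs fun i hi => ?_)
    have hpi := (hp.1 i).1
    have := (hli i (Finset.ne_of_mem_erase hi)).2
    exact mul_lt_mul_of_pos_left (Real.rpow_lt_rpow (by positivity) this (by linarith))
      (by positivity)

theorem optRedundancy_lt_upperBound {n : ℕ} {d : ℝ} (hd : -1 < d) (hd0 : d ≠ 0) {p : Fin n → ℝ}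
    (hp : IsSource p) (j : Fin n) : optRedundancy d p < upperBound d (p j) := by
  obtain ⟨m, hm⟩ := (upperTerm_isLeast hd hd0 (hp.1 j).1 (hp.1 j).2).1
  rw [← hm]
  exact optRedundancy_lt_upperTerm hd0 hp j m

/-- Take `m` with `x/2 < 2^(-m) ≤ x`. Replacing the masses `2^(-m)` and `1 - 2^(-m)` by the smaller
or equal values `x/2` and `1 - x` can only raise the upper term, and there it equals `1`. -/
theorem upperBound_le_one {d x : ℝ} (hd : -1 < d) (hd0 : d ≠ 0) (hx0 : 0 < x) (hx1 : x < 1) :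
    upperBound d x ≤ 1 := by
  obtain ⟨l, h1, h2⟩ := exists_half_pow_near hx0 hx1.le
  have hl : 0 < l := by
    rcases Nat.eq_zero_or_pos l with rfl | h
    · simp at h1; linarith
    · exact h
  obtain ⟨m, rfl⟩ : ∃ m : ℕ+, (m : ℕ) = l := ⟨⟨l, hl⟩, rfl⟩
  refine ((upperTerm_isLeast hd hd0 hx0 hx1).2 ⟨m, rfl⟩).trans ?_
  have hy : 0 < 1 - x := by linarith
  have hq := half_pow_lt_one m
  rw [upperTerm_eq_boundTerm, boundTerm_eq hd0 (by positivity) hx0 hx1]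
  set q := (1 / 2 : ℝ) ^ (m : ℕ) with hqdef
  have hq0 : 0 < q := by positivity
  have hq' : 0 < 1 - q := by linarith
  have e1 : (1 : ℝ) = 1 / d * Real.logb 2 (2 ^ d) := by
    rw [Real.logb_rpow (by norm_num) (by norm_num)]; field_simp
  have e2 : x ^ (1 + d) * (x / 2) ^ (-d) = 2 ^ d * x := by
    rw [Real.div_rpow hx0.le (by norm_num), Real.rpow_add hx0, Real.rpow_one,
      Real.rpow_neg hx0.le, Real.rpow_neg (x := 2) (by norm_num)]
    field_simp
  have e3 : (1 - x) ^ (1 + d) * (1 - x) ^ (-d) = 1 - x := by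
    rw [← Real.rpow_add hy, add_neg_cancel_right, Real.rpow_one]
  have e4 : (2 : ℝ) ^ d = x ^ (1 + d) * (x / 2) ^ (-d) +
      2 ^ d * ((1 - x) ^ (1 + d) * (1 - x) ^ (-d)) := by
    rw [e2, e3]; ring
  refine le_of_le_of_eq ?_ e1.symm
  refine scaledLog_le hd0 (by positivity) (by positivity) (fun h => ?_) (fun h => ?_)
  · conv_rhs => rw [e4]
    have := Real.rpow_le_rpow_of_nonpos (z := -d) (by positivity) h2.le (by linarith)
    have := Real.rpow_le_rpow_of_nonpos (z := -d) hy (show 1 - x ≤ 1 - q by linarith)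
      (by linarith)
    gcongr
  · conv_lhs => rw [e4]
    have := Real.rpow_le_rpow (z := -d) (by positivity) h2.le (by linarith)
    have := Real.rpow_le_rpow (z := -d) hy.le (show 1 - x ≤ 1 - q by linarith)
      (by linarith)
    gcongr

/-! ### Sharpness of the two bounds -/

/-- The lower bound is attained: all symbols but the most probable one are equiprobable. -/
theorem exists_optRedundancy_eq_lowerBound {d x : ℝ} (hd : -1 < d) (hd0 : d ≠ 0) (hx0 : 0 < x)
    (hx1 : x < 1) : ∃ (n : ℕ) (p : Fin (n + 1) → ℝ), IsSource p ∧ Antitone p ∧ p 0 = x ∧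
      optRedundancy d p = lowerBound d x := by
  obtain ⟨m, hm⟩ := (lowerTerm_isLeast hd hd0 hx0 hx1).1
  have hy : 0 < 1 - x := by linarith
  have hq := half_pow_lt_one m
  have hm1 := two_pow_sub_one_pos m
  -- With `N = (2^m - 1) * 2^k` further symbols, words of length `m + k` use up exactly `1 -
  -- 2^(-m)`; a large `k` makes each of these symbols no more probable than `x`.
  obtain ⟨k, hk⟩ := exists_pow_lt_of_lt_one (mul_pos hx0 hm1) (by norm_num : (1 / 2 : ℝ) < 1)
  obtain ⟨N, hN⟩ : ∃ N : ℕ, (N : ℝ) = (2 ^ (m : ℕ) - 1) * 2 ^ k := by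
    refine ⟨(2 ^ (m : ℕ) - 1) * 2 ^ k, ?_⟩
    rw [Nat.cast_mul, Nat.cast_sub Nat.one_le_two_pow]
    push_cast
    rfl
  have hN0 : (0 : ℝ) < N := by rw [hN]; positivity
  have hN1 : (1 : ℝ) ≤ N := by exact_mod_cast (Nat.cast_pos.1 hN0 : 0 < N)
  set z := (1 - x) / N with hz
  have hz0 : 0 < z := by positivity
  have hz1 : z < 1 := (div_le_self hy.le hN1).trans_lt (by linarith)
  have hzx : z ≤ x := by
    rw [hz, div_le_iff₀ hN0, hN]
    rw [one_div, inv_pow, inv_lt_iff_one_lt_mul₀ (by positivity)] at hk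
    linarith
  set q := (1 / 2 : ℝ) ^ (m : ℕ) with hqdef
  have hq' : 0 < 1 - q := by linarith
  have hr : (1 / 2 : ℝ) ^ ((m : ℕ) + k) = (1 - q) / N := by
    rw [hN, hqdef, pow_add, one_div, inv_pow, inv_pow]
    field_simp
  let p : Fin (N + 1) → ℝ := Fin.cons x fun _ => z
  let l : Fin (N + 1) → ℕ := Fin.cons (m : ℕ) fun _ => (m : ℕ) + k
  have hp : IsSource p := by
    constructor
    · intro i
      refine Fin.cases ?_ (fun i => ?_) i
      · exact ⟨hx0, hx1⟩
      · exact ⟨hz0, hz1⟩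
    · rw [Fin.sum_univ_succ]
      simp only [p, Fin.cons_zero, Fin.cons_succ, Finset.sum_const, Finset.card_univ,
        Fintype.card_fin, nsmul_eq_mul, hz]
      field_simp
      ring
  have hanti : Antitone p := by
    intro i k
    refine Fin.cases (fun h => ?_) (fun k _ => ?_) k
    · rw [Fin.le_zero_iff.1 h]
    · refine Fin.cases ?_ (fun i => ?_) i
      · exact hzx
      · exact le_rfl
  have hK : ∑ i, (1 / 2 : ℝ) ^ l i ≤ 1 := by
    rw [Fin.sum_univ_succ]
    simp only [l, Fin.cons_zero, Fin.cons_succ, Finset.sum_const, Finset.card_univ,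
      Fintype.card_fin, nsmul_eq_mul, hr]
    rw [← hqdef]
    field_simp
    linarith
  have hval : expRedundancy d p l = lowerTerm d x m := by
    rw [lowerTerm_eq_boundTerm, boundTerm_eq hd0 one_pos hx0 hx1, expRedundancy_eq,
      Fin.sum_univ_succ]
    simp only [p, l, Fin.cons_zero, Fin.cons_succ, Finset.sum_const, Finset.card_univ,
      Fintype.card_fin, nsmul_eq_mul, hr, one_mul, ← hqdef]
    rw [rpow_mul_rpow_neg hz0.le (by positivity), rpow_mul_rpow_neg hy.le hq', hz,
      div_div_div_cancel_right₀ hN0.ne', ← mul_assoc, mul_div_cancel₀ _ hN0.ne']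
  refine ⟨N, p, hp, hanti, rfl, le_antisymm ?_ (lowerBound_le_optRedundancy hd hd0 hp 0)⟩
  rw [← hm, ← hval]
  exact optRedundancy_le hd0 hp hK

theorem swap_rpow_le {d a b : ℝ} (hd : -1 < d) (hb : 0 < b) (hab : b ≤ a) :
    (0 < d → a ^ (1 + d) * 2 ^ (d * 1) + b ^ (1 + d) * 2 ^ (d * 2) ≤
      a ^ (1 + d) * 2 ^ (d * 2) + b ^ (1 + d) * (2 : ℝ) ^ (d * 1)) ∧
    (d < 0 → a ^ (1 + d) * 2 ^ (d * 2) + b ^ (1 + d) * (2 : ℝ) ^ (d * 1) ≤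
      a ^ (1 + d) * 2 ^ (d * 1) + b ^ (1 + d) * 2 ^ (d * 2)) := by
  have h1 : b ^ (1 + d) ≤ a ^ (1 + d) := Real.rpow_le_rpow hb.le hab (by linarith)
  constructor
  · intro h
    have : (2 : ℝ) ^ (d * 1) ≤ 2 ^ (d * 2) :=
      Real.rpow_le_rpow_of_exponent_le (by norm_num) (by linarith)
    nlinarith
  · intro h
    have : (2 : ℝ) ^ (d * 2) ≤ 2 ^ (d * 1) :=
      Real.rpow_le_rpow_of_exponent_le (by norm_num) (by linarith)
    nlinarith

/-- For three symbols, the lengths `1, 2, 2` in order of probability are optimal. -/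
theorem expRedundancy_one_two_two_le {d a b c : ℝ} (hd : -1 < d) (hd0 : d ≠ 0)
    (hp : IsSource ![a, b, c]) (hab : b ≤ a) (hac : c ≤ a) :
    expRedundancy d ![a, b, c] ![1, 2, 2] ≤ optRedundancy d ![a, b, c] := by
  have ha : 0 < a := (hp.1 0).1
  have hb : 0 < b := (hp.1 1).1
  have hc : 0 < c := (hp.1 2).1
  have e1 : expRedundancy d ![a, b, c] ![1, 2, 2] ≤ expRedundancy d ![a, b, c] ![2, 1, 2] := by
    simp only [expRedundancy, Fin.sum_univ_three, Matrix.cons_val, Nat.cast_one, Nat.cast_ofNat]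
    refine scaledLog_le hd0 (by positivity) (by positivity) (fun h => ?_) (fun h => ?_)
    · linarith [(swap_rpow_le hd hb hab).1 h]
    · linarith [(swap_rpow_le hd hb hab).2 h]
  have e2 : expRedundancy d ![a, b, c] ![1, 2, 2] ≤ expRedundancy d ![a, b, c] ![2, 2, 1] := by
    simp only [expRedundancy, Fin.sum_univ_three, Matrix.cons_val, Nat.cast_one, Nat.cast_ofNat]
    refine scaledLog_le hd0 (by positivity) (by positivity) (fun h => ?_) (fun h => ?_)
    · linarith [(swap_rpow_le hd hc hac).1 h]
    · linarith [(swap_rpow_le hd hc hac).2 h]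
  refine le_optRedundancy hd0 hp fun l hl hK => ?_
  -- Two words of length `1` exhaust Kraft's sum and leave no room for the third. Hence every
  -- admissible length vector dominates an arrangement of `1, 2, 2`, and exchange plus monotonicity
  -- finish.
  have hone : ∀ i k : Fin 3, i ≠ k → l i = 1 → 2 ≤ l k := by
    intro i k hik hi
    by_contra! hk
    have hk1 : l k = 1 := by have := hl k; omega
    obtain ⟨j, hji, hjk⟩ : ∃ j : Fin 3, j ≠ i ∧ j ≠ k := by
      clear hi hk hk1; revert i k; decide
    have hsub : ∑ t ∈ ({i, k, j} : Finset (Fin 3)), (1 / 2 : ℝ) ^ l t ≤ 1 :=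
      (Finset.sum_le_sum_of_subset_of_nonneg (Finset.subset_univ _)
        (fun t _ _ => by positivity)).trans hK
    rw [Finset.sum_insert (by simp [hik, hji.symm]), Finset.sum_insert (by simp [hjk.symm]),
      Finset.sum_singleton, hi, hk1] at hsub
    have : (0 : ℝ) < (1 / 2) ^ l j := by positivity
    linarith
  have hmono := expRedundancy_mono hd0 hp
  by_cases h0 : l 0 = 1
  · refine hmono fun i => ?_
    fin_cases i
    · exact h0.ge
    · exact hone 0 1 (by decide) h0
    · exact hone 0 2 (by decide) h0
  · have h0' : 2 ≤ l 0 := by have := hl 0; omega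
    by_cases h1 : l 1 = 1
    · refine e1.trans (hmono fun i => ?_)
      fin_cases i
      · exact h0'
      · exact h1.ge
      · exact hone 1 2 (by decide) h1
    · refine e2.trans (hmono fun i => ?_)
      fin_cases i
      · exact h0'
      · have := hl 1
        change 2 ≤ l 1
        omega
      · exact hl 2

/-- For the source `(x, 1 - x - e, e)` the lengths `1, 2, 2` are optimal. As `e → 0` the third
symbol stops contributing but still costs the second one a bit, so the redundancy tends to
`upperTerm d x 1`, which is at least `upperBound d x`. -/
theorem exists_upperBound_sub_lt_optRedundancy {d x ε : ℝ} (hd : -1 < d) (hd0 : d ≠ 0)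
    (hx : 1 / 2 ≤ x) (hx1 : x < 1) (hε : 0 < ε) :
    ∃ (n : ℕ) (p : Fin (n + 1) → ℝ), IsSource p ∧ Antitone p ∧ p 0 = x ∧
      upperBound d x - ε < optRedundancy d p := by
  have hx0 : 0 < x := by linarith
  have hy : 0 < 1 - x := by linarith
  let f : ℝ → ℝ := fun e => expRedundancy d ![x, 1 - x - e, e] ![1, 2, 2]
  have hf0 : f 0 = upperTerm d x 1 := by
    have h2 : (2 : ℝ) ^ (d * 2) = 2 ^ d * 2 ^ d := by
      rw [mul_two, Real.rpow_add (by norm_num)]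
    simp only [f, expRedundancy, Fin.sum_univ_three, Matrix.cons_val, Nat.cast_one,
      Nat.cast_ofNat, sub_zero, Real.zero_rpow (show 1 + d ≠ 0 by linarith), zero_mul, add_zero]
    rw [upperTerm, add_scaledLog hd0 (by norm_num; positivity), h2]
    norm_num
    left
    congr 1
    ring
  have hcont : ContinuousAt f 0 := by
    simp only [f, expRedundancy, Fin.sum_univ_three, Matrix.cons_val]
    refine ContinuousAt.mul continuousAt_const (ContinuousAt.div_const (ContinuousAt.log ?_ ?_) _)
    · refine ContinuousAt.add (ContinuousAt.add continuousAt_const ?_) ?_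
      · exact ((by fun_prop : ContinuousAt (fun e : ℝ => 1 - x - e) 0).rpow_const
          (Or.inr (by linarith))).mul continuousAt_const
      · exact (continuousAt_id.rpow_const (Or.inr (by linarith))).mul continuousAt_const
    · simp only [sub_zero, Real.zero_rpow (show 1 + d ≠ 0 by linarith)]
      positivity
  have hev := hcont.eventually (lt_mem_nhds (show f 0 - ε < f 0 by linarith))
  obtain ⟨δ, hδ, hball⟩ := Metric.eventually_nhds_iff.1 hev
  -- The cap `(1 - x) / 2` keeps the last two probabilities in order; `1 - x - e ≤ x` comes from `x
  -- ≥ 1/2`.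
  let e := min (δ / 2) ((1 - x) / 2)
  have he0 : 0 < e := by positivity
  have he1 : e < δ := (min_le_left _ _).trans_lt (by linarith)
  have he2 : e ≤ (1 - x) / 2 := min_le_right _ _
  have hfe := hball (y := e) (by rw [Real.dist_eq, sub_zero, abs_of_pos he0]; exact he1)
  have hp : IsSource ![x, 1 - x - e, e] := by
    constructor
    · intro i
      fin_cases i
      · exact ⟨hx0, hx1⟩
      · constructor <;> simp <;> linarith
      · constructor <;> simp <;> linarith
    · simp only [Fin.sum_univ_three, Matrix.cons_val]
      ring
  refine ⟨2, ![x, 1 - x - e, e], hp, ?_, rfl, ?_⟩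
  · rw [Fin.antitone_iff_succ_le]
    intro i
    fin_cases i
    · change 1 - x - e ≤ x
      linarith
    · change e ≤ 1 - x - e
      linarith
  · have h1 := expRedundancy_one_two_two_le hd hd0 hp (by linarith) (by linarith)
    have h2 := (upperTerm_isLeast hd hd0 hx0 hx1).2 ⟨1, rfl⟩
    rw [hf0] at hfe
    exact (lt_of_le_of_lt (by linarith) hfe).trans_le h1

/-! ### Linear redundancy below one half -/

theorem half_pow_eq_mul_rpow {q : ℝ} (hq : 0 < q) (l : ℕ) :
    (1 / 2 : ℝ) ^ l = q * 2 ^ (-((l : ℝ) + Real.logb 2 q)) := by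
  rw [neg_add, Real.rpow_add (by norm_num), Real.rpow_neg (by norm_num) (Real.logb 2 q),
    Real.rpow_logb (by norm_num) (by norm_num) hq, Real.rpow_neg (by norm_num),
    Real.rpow_natCast, one_div, inv_pow]
  field_simp

/-- A convex function lies below its chord on `[0, 1]`; here this is Bernoulli's inequality for `(1
- 1/2)^u`. -/
theorem two_rpow_neg_le {u : ℝ} (h0 : 0 ≤ u) (h1 : u ≤ 1) : (2 : ℝ) ^ (-u) ≤ 1 - u / 2 := by
  have h := rpow_one_add_le_one_add_mul_self (s := -(1 / 2)) (by norm_num) h0 h1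
  rw [show (1 : ℝ) + -(1 / 2) = 2⁻¹ by norm_num, Real.inv_rpow (by norm_num),
    ← Real.rpow_neg (by norm_num)] at h
  linarith

/-- Tangent at `t = 1/2`: its slope is `-√2 log 2`, between `-1` and `-0.98`, and its value at `0`
is about `1.904`, so it stays above `19/10 - t` for `t ≥ 0`. -/
theorem two_mul_two_rpow_neg_ge {t : ℝ} (h0 : 0 ≤ t) :
    19 / 10 - t ≤ 2 * (2 : ℝ) ^ (-t) := by
  have hs : (1.4142 : ℝ) ≤ √2 := by
    rw [Real.le_sqrt (by norm_num) (by norm_num)]; norm_num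
  have hs' : √2 ≤ 1.4143 := by
    rw [Real.sqrt_le_left (by norm_num)]; norm_num
  have e : 2 * (2 : ℝ) ^ (-t) = √2 * 2 ^ (1 / 2 - t) := by
    rw [Real.sqrt_eq_rpow, ← Real.rpow_add (by norm_num)]
    nth_rewrite 1 [← Real.rpow_one 2]
    rw [← Real.rpow_add (by norm_num)]
    ring_nf
  have h2 : 1 + (1 / 2 - t) * Real.log 2 ≤ (2 : ℝ) ^ (1 / 2 - t) := by
    rw [Real.rpow_def_of_pos (by norm_num)]
    linarith [Real.add_one_le_exp (Real.log 2 * (1 / 2 - t))]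
  rw [e]
  have h3 : √2 * (1 + (1 / 2 - t) * Real.log 2) ≤ √2 * 2 ^ (1 / 2 - t) := by gcongr
  refine le_trans ?_ h3
  have hl := Real.log_two_gt_d9
  have hl' := Real.log_two_lt_d9
  have hp : 0.98 ≤ √2 * Real.log 2 := by nlinarith
  have hp' : √2 * Real.log 2 ≤ 1 := by nlinarith
  have : √2 * (1 + (1 / 2 - t) * Real.log 2) = √2 + (1 / 2 - t) * (√2 * Real.log 2) := by ring
  rw [this]
  rcases le_total t (1 / 2) with h | h
  · nlinarith
  · nlinarith

/-- A weak form of Gallager's bound on the linear redundancy. -/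
theorem exists_lengths_linear_redundancy_lt {ι : Type*} [DecidableEq ι] {s : Finset ι}
    {q : ι → ℝ} {M : ℝ} (hs : s.Nonempty) (hq0 : ∀ i ∈ s, 0 < q i) (hq1 : ∀ i ∈ s, q i < 1)
    (hM : ∀ i ∈ s, q i ≤ M) :
    ∃ l : ι → ℕ, ∑ i ∈ s, (1 / 2 : ℝ) ^ l i ≤ ∑ i ∈ s, q i ∧
      ∑ i ∈ s, q i * ((l i : ℝ) + Real.logb 2 (q i)) < M + 1 / 10 * ∑ i ∈ s, q i := by
  set Q := ∑ i ∈ s, q i with hQ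
  have hQ0 : 0 < Q := Finset.sum_pos hq0 hs
  have hM0 : 0 < M := by
    obtain ⟨i, hi⟩ := hs
    exact (hq0 i hi).trans_le (hM i hi)
  let c : ι → ℕ := fun i => ⌈-Real.logb 2 (q i)⌉₊
  -- Rounding the ideal length down instead of up lowers it by `t i`, a number in `[0, 1]`; the set
  -- `S` below collects the symbols rounded down.
  let t : ι → ℝ := fun i => -Real.logb 2 (q i) - ((c i : ℝ) - 1)
  have hlog : ∀ i ∈ s, 0 < -Real.logb 2 (q i) := fun i hi =>
    neg_pos.2 (Real.logb_neg one_lt_two (hq0 i hi) (hq1 i hi))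
  have hc1 : ∀ i ∈ s, 1 ≤ c i := fun i hi => Nat.ceil_pos.2 (hlog i hi)
  have ht0 : ∀ i ∈ s, 0 ≤ t i := fun i hi => by
    have := Nat.ceil_lt_add_one (hlog i hi).le
    simp only [t, c]; linarith
  have ht1 : ∀ i ∈ s, t i ≤ 1 := fun i hi => by
    have := Nat.le_ceil (-Real.logb 2 (q i))
    simp only [t, c]; linarith
  let l : Finset ι → ι → ℕ := fun S i => if i ∈ S then c i - 1 else c i
  have hδ1 : ∀ S, ∀ i ∈ s, i ∈ S → (l S i : ℝ) + Real.logb 2 (q i) = -t i := by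
    intro S i hi hiS
    simp only [l, hiS, if_true, t, Nat.cast_sub (hc1 i hi)]
    push_cast; ring
  have hδ2 : ∀ S, ∀ i ∈ s, i ∉ S → (l S i : ℝ) + Real.logb 2 (q i) = 1 - t i := by
    intro S i hi hiS
    simp only [l, hiS, if_false, t]
    ring
  -- Admissible sets are closed under smaller `t` and obey Kraft. A largest one is cut off at the
  -- least remaining `t a`: adding `a` must break Kraft.
  let family := s.powerset.filter fun S =>
    (∀ i ∈ S, ∀ j ∈ s, t j < t i → j ∈ S) ∧ ∑ i ∈ s, (1 / 2 : ℝ) ^ l S i ≤ Q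
  have hempty : ∅ ∈ family := by
    simp only [family, Finset.mem_filter, Finset.mem_powerset, Finset.empty_subset, true_and]
    refine ⟨by simp, Finset.sum_le_sum fun i hi => ?_⟩
    rw [half_pow_eq_mul_rpow (hq0 i hi), hδ2 ∅ i hi (by simp)]
    have : (2 : ℝ) ^ (-(1 - t i)) ≤ 1 :=
      Real.rpow_le_one_of_one_le_of_nonpos (by norm_num) (by linarith [ht1 i hi])
    have := hq0 i hi
    nlinarith
  obtain ⟨S, hS, hmax⟩ := Finset.exists_max_image family Finset.card ⟨∅, hempty⟩
  obtain ⟨hSs, hdown, hK⟩ : S ⊆ s ∧ (∀ i ∈ S, ∀ j ∈ s, t j < t i → j ∈ S) ∧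
      ∑ i ∈ s, (1 / 2 : ℝ) ^ l S i ≤ Q := by
    simpa only [family, Finset.mem_filter, Finset.mem_powerset] using hS
  refine ⟨l S, hK, ?_⟩
  by_cases hall : S = s
  · have : ∑ i ∈ s, q i * ((l S i : ℝ) + Real.logb 2 (q i)) ≤ 0 := by
      refine Finset.sum_nonpos fun i hi => ?_
      rw [hδ1 S i hi (hall ▸ hi)]
      have := ht0 i hi
      have := hq0 i hi
      nlinarith
    have : 0 < M + 1 / 10 * Q := by positivity
    linarith
  have hne : (s \ S).Nonempty := by
    rw [Finset.sdiff_nonempty]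
    exact fun h => hall (hSs.antisymm h)
  obtain ⟨a, ha, hmin⟩ := Finset.exists_min_image (s \ S) t hne
  obtain ⟨has, haS⟩ := Finset.mem_sdiff.1 ha
  have hK' : Q < ∑ i ∈ s, (1 / 2 : ℝ) ^ l (insert a S) i := by
    by_contra! h
    have hmem : insert a S ∈ family := by
      simp only [family, Finset.mem_filter, Finset.mem_powerset]
      refine ⟨Finset.insert_subset has hSs, fun i hi j hj hji => ?_, h⟩
      rcases Finset.mem_insert.1 hi with rfl | hi
      · by_contra hjS
        have := hmin j (Finset.mem_sdiff.2 ⟨hj, fun h => hjS (Finset.mem_insert_of_mem h)⟩)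
        linarith
      · exact Finset.mem_insert_of_mem (hdown i hi j hj hji)
    have := hmax _ hmem
    rw [Finset.card_insert_of_notMem haS] at this
    omega
  -- After adding `a`, all deviations from the ideal lengths lie in the unit interval `[-t a, 1 - t
  -- a]`. The chord bound there makes the violated Kraft inequality linear in the deviations, which
  -- bounds their mean.
  have hbound : ∀ i ∈ s, (1 / 2 : ℝ) ^ l (insert a S) i ≤ q i * (2 ^ t a *
      (1 - ((l (insert a S) i : ℝ) + Real.logb 2 (q i) + t a) / 2)) := by
    intro i hi
    rw [half_pow_eq_mul_rpow (hq0 i hi)]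
    refine mul_le_mul_of_nonneg_left ?_ (hq0 i hi).le
    have hrange : 0 ≤ (l (insert a S) i : ℝ) + Real.logb 2 (q i) + t a ∧
        (l (insert a S) i : ℝ) + Real.logb 2 (q i) + t a ≤ 1 := by
      by_cases hiS : i ∈ insert a S
      · rw [hδ1 _ i hi hiS]
        have hle : t i ≤ t a := by
          rcases Finset.mem_insert.1 hiS with rfl | hiS
          · exact le_rfl
          · by_contra! h
            exact haS (hdown i hiS a has h)
        constructor
        · linarith
        · linarith [ht0 i hi, ht1 a has]
      · rw [hδ2 _ i hi hiS]
        have := hmin i (Finset.mem_sdiff.2 ⟨hi, fun h => hiS (Finset.mem_insert_of_mem h)⟩)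
        constructor
        · linarith [ht1 i hi, ht0 a has]
        · linarith
    have := two_rpow_neg_le hrange.1 hrange.2
    rw [show -((l (insert a S) i : ℝ) + Real.logb 2 (q i)) =
      t a + -((l (insert a S) i : ℝ) + Real.logb 2 (q i) + t a) by ring,
      Real.rpow_add (by norm_num)]
    gcongr
  have hsum := hK'.trans_le (Finset.sum_le_sum hbound)
  set D := ∑ i ∈ s, q i * ((l (insert a S) i : ℝ) + Real.logb 2 (q i)) with hD
  have hrw : ∑ i ∈ s, q i * (2 ^ t a *
      (1 - ((l (insert a S) i : ℝ) + Real.logb 2 (q i) + t a) / 2)) =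
      2 ^ t a * (Q - (D + t a * Q) / 2) := by
    rw [hD, hQ, Finset.mul_sum, ← Finset.sum_add_distrib, Finset.sum_div,
      ← Finset.sum_sub_distrib, Finset.mul_sum]
    exact Finset.sum_congr rfl fun i _ => by ring
  rw [hrw] at hsum
  have hdiff : ∑ i ∈ s, q i * ((l S i : ℝ) + Real.logb 2 (q i)) = D + q a := by
    have : ∀ i ∈ s, q i * ((l S i : ℝ) + Real.logb 2 (q i)) =
        q i * ((l (insert a S) i : ℝ) + Real.logb 2 (q i)) + if i = a then q i else 0 := by
      intro i hi
      by_cases hia : i = a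
      · subst hia
        rw [hδ2 _ i hi haS, hδ1 _ i hi (Finset.mem_insert_self _ _), if_pos rfl]
        ring
      · have : l S i = l (insert a S) i := by simp [l, hia]
        rw [this, if_neg hia, add_zero]
    rw [Finset.sum_congr rfl this, Finset.sum_add_distrib, Finset.sum_ite_eq' s a, if_pos has]
  -- This gives `D < Q / 10`; returning from `insert a S` to `S` adds only `q a ≤ M`.
  have htan := two_mul_two_rpow_neg_ge (ht0 a has)
  have h2 : Q * 2 ^ (-t a) < Q - (D + t a * Q) / 2 := by
    rw [Real.rpow_neg (by norm_num), ← div_eq_mul_inv, div_lt_iff₀ (by positivity)]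
    linarith
  rw [hdiff]
  have := hM a has
  nlinarith

theorem logb_two_le {z : ℝ} (hz : 0 < z) : Real.logb 2 z ≤ (z - 1) / Real.log 2 := by
  rw [Real.logb]
  exact div_le_div_of_nonneg_right (Real.log_le_sub_one_of_pos hz) (Real.log_pos one_lt_two).le

theorem logb_two_mul {z : ℝ} (hz : 0 < z) : Real.logb 2 (2 * z) = 1 + Real.logb 2 z := by
  rw [Real.logb_mul (by norm_num) hz.ne', Real.logb_self_eq_one one_lt_two]

theorem inv_log_two_bounds : 1.44 < (Real.log 2)⁻¹ ∧ (Real.log 2)⁻¹ < 1.45 := by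
  have h1 := Real.log_two_gt_d9
  have h2 := Real.log_two_lt_d9
  have h0 : 0 < Real.log 2 := by linarith
  constructor
  · rw [lt_inv_comm₀ (by norm_num) h0]; norm_num; linarith
  · rw [inv_lt_comm₀ h0 (by norm_num)]; norm_num; linarith

/-- One symbol of probability just below one half, all others considerably less probable. -/
theorem exists_linear_redundancy_lt_half_of_one {n : ℕ} {p : Fin n → ℝ} (hp : IsSource p)
    {a : Fin n} (ha1 : p a < 1 / 2) (ha2 : 2 / 5 < p a) (hothers : ∀ i, i ≠ a → p i ≤ 7 / 20) :
    ∃ l : Fin n → ℕ, ∑ i, (1 / 2 : ℝ) ^ l i ≤ 1 ∧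
      ∑ i, p i * ((l i : ℝ) + Real.logb 2 (p i)) < 1 / 2 := by
  have hsum := hp.sum_erase a
  set r := 1 - p a with hr
  have hr0 : 0 < r := by linarith
  have hQ : ∑ i ∈ Finset.univ.erase a, p i / (2 * r) = 1 / 2 := by
    rw [← Finset.sum_div, hsum]; field_simp
  have hle : ∀ i ∈ Finset.univ.erase a, p i / (2 * r) ≤ 7 / 20 / (2 * r) := fun i hi =>
    div_le_div_of_nonneg_right (hothers i (Finset.ne_of_mem_erase hi)) (by positivity)
  obtain ⟨l, hK, hl⟩ := exists_lengths_linear_redundancy_lt (hp.erase_nonempty a)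
    (q := fun i => p i / (2 * r)) (M := 7 / 20 / (2 * r))
    (fun i _ => div_pos (hp.1 i).1 (by positivity))
    (fun i hi => (hle i hi).trans_lt (by rw [div_lt_one (by positivity)]; linarith)) hle
  rw [hQ] at hK hl
  have hne : ∀ i ∈ Finset.univ.erase a, Function.update l a 1 i = l i := fun i hi =>
    Function.update_of_ne (Finset.ne_of_mem_erase hi) _ _
  refine ⟨Function.update l a 1, ?_, ?_⟩
  · rw [← Finset.add_sum_erase _ _ (Finset.mem_univ a), Function.update_self,
      Finset.sum_congr rfl fun i hi => by rw [hne i hi]]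
    linarith
  · rw [← Finset.add_sum_erase _ _ (Finset.mem_univ a), Function.update_self,
      Finset.sum_congr rfl fun i hi => by rw [hne i hi]]
    have e : ∑ i ∈ Finset.univ.erase a, p i * ((l i : ℝ) + Real.logb 2 (p i)) =
        2 * r * ∑ i ∈ Finset.univ.erase a, p i / (2 * r) *
          ((l i : ℝ) + Real.logb 2 (p i / (2 * r))) + r * Real.logb 2 (2 * r) := by
      have hr' : r * Real.logb 2 (2 * r) =
          ∑ i ∈ Finset.univ.erase a, p i * Real.logb 2 (2 * r) := by
        rw [← Finset.sum_mul, hsum]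
      rw [hr']
      rw [Finset.mul_sum, ← Finset.sum_add_distrib]
      refine Finset.sum_congr rfl fun i _ => ?_
      rw [Real.logb_div (hp.1 i).1.ne' (by positivity)]
      field_simp
      ring
    have hl' := mul_lt_mul_of_pos_left hl (show 0 < 2 * r by positivity)
    have e2 : 2 * r * (7 / 20 / (2 * r) + 1 / 10 * (1 / 2)) = 7 / 20 + r / 10 := by
      field_simp
    rw [e2] at hl'
    rw [e]
    have h1 := logb_two_le (show 0 < 2 * r by positivity)
    have h2 := logb_two_le (show 0 < 2 * p a by linarith)
    rw [logb_two_mul (by linarith)] at h2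
    have h3 := mul_le_mul_of_nonneg_left h1 hr0.le
    have h4 := mul_le_mul_of_nonneg_left h2 (show 0 ≤ p a by linarith)
    have hb := inv_log_two_bounds.2
    -- Because `2 * p a - 1 = -(2 * r - 1)`, the two tangent bounds for the logarithms combine to a
    -- square. With `r < 3/5` the total is below `7/20 + 0.06 + 0.058 < 1/2`.
    have e3 : r * ((2 * r - 1) / Real.log 2) + p a * ((2 * p a - 1) / Real.log 2) =
        (2 * r - 1) ^ 2 * (Real.log 2)⁻¹ := by
      rw [show p a = 1 - r by rw [hr]; ring]
      ring
    have hsq : (2 * r - 1) ^ 2 ≤ 1 / 25 := by nlinarith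
    have : (2 * r - 1) ^ 2 * (Real.log 2)⁻¹ ≤ 1 / 25 * 1.45 :=
      mul_le_mul hsq hb.le (inv_nonneg.2 (Real.log_nonneg one_le_two)) (by norm_num)
    push_cast
    linarith

/-- Two symbols of probability near one half. -/
theorem exists_linear_redundancy_lt_half_of_two {n : ℕ} {p : Fin n → ℝ} (hp : IsSource p)
    {a b : Fin n} (hab : b ≠ a) (ha1 : p a < 1 / 2) (ha2 : 2 / 5 < p a) (hb1 : p b < 1 / 2)
    (hb2 : 7 / 20 < p b) :
    ∃ l : Fin n → ℕ, ∑ i, (1 / 2 : ℝ) ^ l i ≤ 1 ∧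
      ∑ i, p i * ((l i : ℝ) + Real.logb 2 (p i)) < 1 / 2 := by
  have hb : b ∈ Finset.univ.erase a := by simp [hab]
  set s := (Finset.univ.erase a).erase b with hs
  have hsum : ∑ i ∈ s, p i = 1 - p a - p b := by
    have := Finset.add_sum_erase _ p hb
    rw [hp.sum_erase a] at this
    linarith
  set r := 1 - p a - p b with hr
  have hr0 : 0 < r := by linarith
  have hsa : ∀ i ∈ s, i ≠ a := fun i hi => Finset.ne_of_mem_erase (Finset.mem_of_mem_erase hi)
  have hsb : ∀ i ∈ s, i ≠ b := fun i hi => Finset.ne_of_mem_erase hi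
  -- Lengths `1` and `2` for `a` and `b` leave a budget of `1/4`. As `r < 1/4`, a plain Shannon code
  -- on it exceeds the ideal lengths by at most one bit.
  have hex : ∀ i, ∃ k : ℕ, i ∈ s → (1 / 2 : ℝ) ^ k ≤ p i / (4 * r) ∧
      p i / (4 * r) / 2 < (1 / 2 : ℝ) ^ k := by
    intro i
    by_cases hi : i ∈ s
    · have : p i ≤ r := by
        rw [← hsum]
        exact Finset.single_le_sum (fun k _ => (hp.1 k).1.le) hi
      obtain ⟨k, hk⟩ := exists_half_pow_near (div_pos (hp.1 i).1 (by positivity : 0 < 4 * r))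
        (by rw [div_le_one (by positivity)]; linarith)
      exact ⟨k, fun _ => hk⟩
    · exact ⟨0, fun h => absurd h hi⟩
  choose l hl using hex
  let l' : Fin n → ℕ := Function.update (Function.update l b 2) a 1
  have hla : l' a = 1 := by simp [l']
  have hlb : l' b = 2 := by simp [l', hab]
  have hls : ∀ i ∈ s, l' i = l i := fun i hi => by simp [l', hsa i hi, hsb i hi]
  refine ⟨l', ?_, ?_⟩
  · rw [← Finset.add_sum_erase _ _ (Finset.mem_univ a), ← Finset.add_sum_erase _ _ hb, ← hs,
      hla, hlb, Finset.sum_congr rfl fun i hi => by rw [hls i hi]]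
    have : ∑ i ∈ s, (1 / 2 : ℝ) ^ l i ≤ 1 / 4 := by
      calc ∑ i ∈ s, (1 / 2 : ℝ) ^ l i ≤ ∑ i ∈ s, p i / (4 * r) :=
            Finset.sum_le_sum fun i hi => (hl i hi).1
        _ = 1 / 4 := by rw [← Finset.sum_div, hsum]; field_simp
    linarith
  · rw [← Finset.add_sum_erase _ _ (Finset.mem_univ a), ← Finset.add_sum_erase _ _ hb, ← hs,
      hla, hlb, Finset.sum_congr rfl fun i hi => by rw [hls i hi]]
    have hrest : ∑ i ∈ s, p i * ((l i : ℝ) + Real.logb 2 (p i)) ≤ r := by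
      rw [← hsum]
      refine Finset.sum_le_sum fun i hi => ?_
      have hpi := (hp.1 i).1
      have hlt := Real.logb_lt_logb one_lt_two (by positivity) (hl i hi).2
      rw [div_div, Real.logb_div hpi.ne' (by positivity), Real.logb_pow, one_div, Real.logb_inv,
        Real.logb_self_eq_one one_lt_two] at hlt
      have : Real.logb 2 (4 * r * 2) ≤ 1 := by
        rw [Real.logb_le_iff_le_rpow one_lt_two (by positivity), Real.rpow_one]
        linarith
      have : (l i : ℝ) + Real.logb 2 (p i) ≤ 1 := by linarith
      nlinarith
    have hA : p a * (1 + Real.logb 2 (p a)) < -(1 / 2 - p a) := by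
      have h2 := logb_two_le (show 0 < 2 * p a by linarith)
      rw [logb_two_mul (by linarith), div_eq_mul_inv] at h2
      have hi := inv_log_two_bounds.1
      have h3 : (2 * p a - 1) * (Real.log 2)⁻¹ ≤ (2 * p a - 1) * 1.44 :=
        mul_le_mul_of_nonpos_left hi.le (by linarith)
      nlinarith
    have hB : p b * (2 + Real.logb 2 (p b)) ≤ p b := by
      have : Real.logb 2 (p b) ≤ -1 := by
        rw [Real.logb_le_iff_le_rpow one_lt_two (by linarith), Real.rpow_neg_one]
        linarith
      nlinarith
    push_cast
    linarith

/-- The linear redundancy lies below one half if all probabilities do. -/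
theorem exists_linear_redundancy_lt_half {n : ℕ} {p : Fin n → ℝ} (hp : IsSource p)
    (hlt : ∀ i, p i < 1 / 2) :
    ∃ l : Fin n → ℕ, ∑ i, (1 / 2 : ℝ) ^ l i ≤ 1 ∧
      ∑ i, p i * ((l i : ℝ) + Real.logb 2 (p i)) < 1 / 2 := by
  -- The general bound `M + 1/10` reaches exactly `1/2` at `M = 2/5`. Beyond that, the cutoff `7/20`
  -- for a second symbol ensures `1 - 2/5 - 7/20 = 1/4` in the two-symbol case.
  by_cases h1 : ∀ i, p i ≤ 2 / 5
  · have hne : (Finset.univ : Finset (Fin n)).Nonempty := by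
      have := hp.two_le
      exact ⟨⟨0, by omega⟩, Finset.mem_univ _⟩
    obtain ⟨l, hK, hl⟩ := exists_lengths_linear_redundancy_lt hne (q := p) (M := 2 / 5)
      (fun i _ => (hp.1 i).1) (fun i _ => (hp.1 i).2) (fun i _ => h1 i)
    rw [hp.2] at hK hl
    exact ⟨l, hK, hl.trans_le (by norm_num)⟩
  · push Not at h1
    obtain ⟨a, ha⟩ := h1
    by_cases h2 : ∀ i, i ≠ a → p i ≤ 7 / 20
    · exact exists_linear_redundancy_lt_half_of_one hp (hlt a) ha h2
    · push Not at h2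
      obtain ⟨b, hba, hb⟩ := h2
      exact exists_linear_redundancy_lt_half_of_two hp hba (hlt a) ha (hlt b) hb

/-! ### The secondary upper bound for negative `d` -/

/-- For `d < 0` the exponential redundancy is at most the linear one. -/
theorem expRedundancy_le_linear {n : ℕ} {d : ℝ} (hd : d < 0) {p : Fin n → ℝ} (hp : IsSource p)
    (l : Fin n → ℕ) :
    expRedundancy d p l ≤ ∑ i, p i * ((l i : ℝ) + Real.logb 2 (p i)) := by
  -- Jensen for `2^z` with weights `p i`; the negative factor `1/d` then reverses the inequality.
  have hc := (convexOn_rpow_left (b := 2) (by norm_num)).map_sum_le (t := Finset.univ) (w := p)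
    (p := fun i => d * ((l i : ℝ) + Real.logb 2 (p i))) (fun i _ => (hp.1 i).1.le) hp.2
    (fun i _ => Set.mem_univ _)
  simp only [smul_eq_mul] at hc
  have e1 : ∑ i, p i * (d * ((l i : ℝ) + Real.logb 2 (p i))) =
      d * ∑ i, p i * ((l i : ℝ) + Real.logb 2 (p i)) := by
    rw [Finset.mul_sum]
    exact Finset.sum_congr rfl fun i _ => by ring
  have e2 : ∑ i, p i * (2 : ℝ) ^ (d * ((l i : ℝ) + Real.logb 2 (p i))) =
      ∑ i, p i ^ (1 + d) * (2 : ℝ) ^ (d * (l i : ℝ)) := by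
    refine Finset.sum_congr rfl fun i _ => ?_
    have hpi := (hp.1 i).1
    rw [mul_add, Real.rpow_add (by norm_num), mul_comm d (Real.logb 2 (p i)),
      Real.rpow_mul (x := 2) (by norm_num) (Real.logb 2 (p i)), Real.rpow_logb (by norm_num) (by norm_num) hpi,
      Real.rpow_add hpi, Real.rpow_one]
    ring
  rw [e1, e2] at hc
  have hd' := hd.ne
  have e3 : ∑ i, p i * ((l i : ℝ) + Real.logb 2 (p i)) = 1 / d * Real.logb 2
      (2 ^ (d * ∑ i, p i * ((l i : ℝ) + Real.logb 2 (p i)))) := by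
    rw [Real.logb_rpow (by norm_num) (by norm_num)]
    field_simp
  rw [e3]
  have h2 : (0 : ℝ) < 2 ^ (d * ∑ i, p i * ((l i : ℝ) + Real.logb 2 (p i))) := by positivity
  exact scaledLog_le hd.ne (h2.trans_le hc) h2 (fun h => absurd h hd.not_gt) fun _ => hc

theorem upperTerm_one_eq {d y : ℝ} (hd0 : d ≠ 0) (hy0 : 0 < y) (hy1 : y < 1) :
    upperTerm d y 1 =
      1 / d * Real.logb 2 ((1 - y) ^ (1 + d) * (4 : ℝ) ^ d + y ^ (1 + d) * (2 : ℝ) ^ d) := by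
  have hz : 0 < 1 - y := by linarith
  have h4 : (4 : ℝ) ^ d = 2 ^ d * 2 ^ d := by
    rw [← Real.mul_rpow (by norm_num) (by norm_num)]; norm_num
  have h1 : ((2 : ℝ) ^ ((1 : ℕ+) : ℕ) - 1) ^ d = 1 := by norm_num
  rw [upperTerm, h1, div_one, add_scaledLog hd0 (by positivity), h4]
  congr 2
  push_cast
  rw [mul_one]
  ring

theorem concaveOn_upperTerm_one {d : ℝ} (hd : -1 < d) (hd0 : d < 0) :
    ConcaveOn ℝ (Set.Icc 0 1)
      fun y : ℝ => (1 - y) ^ (1 + d) * (4 : ℝ) ^ d + y ^ (1 + d) * (2 : ℝ) ^ d := by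
  have h := (Real.concaveOn_rpow (p := 1 + d) (by linarith) (by linarith)).2
  refine ⟨convex_Icc 0 1, fun x hx y hy a b ha hb hab => ?_⟩
  have h1 := h hx.1 hy.1 ha hb hab
  have h2 := h (sub_nonneg.2 hx.2) (sub_nonneg.2 hy.2) ha hb hab
  simp only [smul_eq_mul] at h1 h2 ⊢
  rw [show a * (1 - x) + b * (1 - y) = 1 - (a * x + b * y) by linear_combination hab] at h2
  have h3 := mul_le_mul_of_nonneg_right h1 (show (0 : ℝ) ≤ 2 ^ d by positivity)
  have h4 := mul_le_mul_of_nonneg_right h2 (show (0 : ℝ) ≤ 4 ^ d by positivity)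
  linarith

/-- With `s = 2^(d/2)` this is `s ≤ (1 + s^2) / 2`. -/
theorem upperTerm_one_half_le {d : ℝ} (hd0 : d < 0) : upperTerm d (1 / 2) 1 ≤ 1 / 2 := by
  have hd' := hd0.ne
  have e1 : (1 / 2 : ℝ) = 1 / d * Real.logb 2 (2 ^ (d / 2)) := by
    rw [Real.logb_rpow (by norm_num) (by norm_num)]
    field_simp
  have h4 : (4 : ℝ) ^ d = 2 ^ d * 2 ^ d := by
    rw [← Real.mul_rpow (by norm_num) (by norm_num)]; norm_num
  have h2 : (2 : ℝ) ^ d = 2 ^ (d / 2) * 2 ^ (d / 2) := by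
    rw [← Real.rpow_add (by norm_num)]; ring_nf
  have hh : (1 - 1 / 2 : ℝ) ^ (1 + d) * 4 ^ d + (1 / 2) ^ (1 + d) * 2 ^ d =
      (1 + 2 ^ (d / 2) * 2 ^ (d / 2)) / 2 := by
    rw [h4, show (1 - 1 / 2 : ℝ) = 1 / 2 by norm_num, Real.rpow_add (by norm_num), Real.rpow_one,
      one_div, Real.inv_rpow (by norm_num), ← h2]
    field_simp
    ring
  rw [upperTerm_one_eq hd0.ne (by norm_num) (by norm_num), hh]
  refine le_of_le_of_eq ?_ e1.symm
  refine scaledLog_le hd0.ne (by positivity) (by positivity)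
    (fun h => absurd h hd0.not_gt) fun _ => ?_
  nlinarith [sq_nonneg ((2 : ℝ) ^ (d / 2) - 1)]

theorem optRedundancy_lt_max {n : ℕ} {d : ℝ} (hd : -1 < d) (hd0 : d < 0) {p : Fin n → ℝ}
    (hp : IsSource p) {j : Fin n} (hj : p j < 1 / 2) :
    optRedundancy d p < max (1 / 2) (1 / d * Real.logb 2
      (p j ^ (1 + d) * (4 : ℝ) ^ d + (1 - p j) ^ (1 + d) * (2 : ℝ) ^ d)) := by
  by_cases hlt : ∀ i, p i < 1 / 2
  · obtain ⟨l, hK, hl⟩ := exists_linear_redundancy_lt_half hp hlt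
    exact ((optRedundancy_le hd0.ne hp hK).trans (expRedundancy_le_linear hd0 hp l)).trans_lt
      (hl.trans_le (le_max_left _ _))
  · push Not at hlt
    obtain ⟨i, hi⟩ := hlt
    have hij : i ≠ j := by rintro rfl; linarith
    have hsum : p i ≤ 1 - p j := by
      rw [← hp.sum_erase j]
      exact Finset.single_le_sum (fun k _ => (hp.1 k).1.le) (by simp [hij])
    have hx0 := (hp.1 j).1
    refine (optRedundancy_lt_upperTerm hd0.ne hp i 1).trans_le ?_
    -- A concave function on `[1/2, 1 - p j]` is smallest at an endpoint; since `1/d < 0`, the upper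
    -- term is largest there. The two endpoints give the two entries of the maximum.
    have hmin := (concaveOn_upperTerm_one hd hd0).min_le_of_mem_Icc
      (x := 1 / 2) (y := 1 - p j) (z := p i) ⟨by norm_num, by norm_num⟩
      ⟨by linarith, by linarith⟩ ⟨hi, hsum⟩
    have hpos : ∀ y : ℝ, 0 < y → y < 1 →
        0 < (1 - y) ^ (1 + d) * (4 : ℝ) ^ d + y ^ (1 + d) * (2 : ℝ) ^ d := by
      intro y h0 h1
      have : 0 < 1 - y := by linarith
      positivity
    have hmono : ∀ y : ℝ, 0 < y → y < 1 →
        (1 - y) ^ (1 + d) * (4 : ℝ) ^ d + y ^ (1 + d) * (2 : ℝ) ^ d ≤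
          (1 - p i) ^ (1 + d) * (4 : ℝ) ^ d + p i ^ (1 + d) * (2 : ℝ) ^ d →
        upperTerm d (p i) 1 ≤ upperTerm d y 1 := by
      intro y h0 h1 h
      rw [upperTerm_one_eq hd0.ne h0 h1, upperTerm_one_eq hd0.ne (hp.1 i).1 (hp.1 i).2]
      exact scaledLog_le hd0.ne (hpos _ (hp.1 i).1 (hp.1 i).2) (hpos y h0 h1)
        (fun h => absurd h hd0.not_gt) fun _ => h
    rcases min_le_iff.1 hmin with h | h
    · exact ((hmono _ (by norm_num) (by norm_num) h).trans (upperTerm_one_half_le hd0)).trans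
        (le_max_left _ _)
    · have := hmono _ (by linarith) (by linarith) h
      rw [upperTerm_one_eq hd0.ne (by linarith) (by linarith) (y := 1 - p j),
        sub_sub_cancel] at this
      exact this.trans (le_max_right _ _)

theorem theorem2 (d : ℝ) (hd : -1 < d) (hd0 : d ≠ 0) :
    -- the two minima exist
    (∀ x : ℝ, 0 < x → x < 1 →
      IsLeast (Set.range (upperTerm d x)) (upperBound d x) ∧
      IsLeast (Set.range (lowerTerm d x)) (lowerBound d x)) ∧
    -- the transition points
    HasTransitions (upperTerm d) (upperBound d) (upperTransition d) ∧
    HasTransitions (lowerTerm d) (lowerBound d) (lowerTransition d) ∧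
    -- an optimal code exists, and the bounds hold for every known probability
    (∀ (n : ℕ) (p : Fin n → ℝ), IsSource p →
      IsLeast (redundancyValues d p) (optRedundancy d p) ∧
      ∀ j : Fin n,
        0 ≤ lowerBound d (p j) ∧
        lowerBound d (p j) ≤ optRedundancy d p ∧
        optRedundancy d p < upperBound d (p j) ∧
        upperBound d (p j) ≤ 1) ∧
    -- the lower bound is achieved, with the given probability the largest one
    (∀ x : ℝ, 0 < x → x < 1 →
      ∃ (n : ℕ) (p : Fin (n + 1) → ℝ), IsSource p ∧ Antitone p ∧ p 0 = x ∧
        optRedundancy d p = lowerBound d x) ∧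
    -- the upper bound is approached, when the largest probability is at least one half
    (∀ x : ℝ, 1 / 2 ≤ x → x < 1 → ∀ ε : ℝ, 0 < ε →
      ∃ (n : ℕ) (p : Fin (n + 1) → ℝ), IsSource p ∧ Antitone p ∧ p 0 = x ∧
        upperBound d x - ε < optRedundancy d p) ∧
    -- the secondary upper bound
    (d < 0 → ∀ (n : ℕ) (p : Fin n → ℝ), IsSource p → ∀ j : Fin n, p j < 1 / 2 →
      optRedundancy d p <
        max (1 / 2) (1 / d * Real.logb 2
          (p j ^ (1 + d) * (4 : ℝ) ^ d + (1 - p j) ^ (1 + d) * (2 : ℝ) ^ d))) := by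
  exact ⟨fun x hx0 hx1 => ⟨upperTerm_isLeast hd hd0 hx0 hx1, lowerTerm_isLeast hd hd0 hx0 hx1⟩,
    upperTerm_hasTransitions hd hd0, lowerTerm_hasTransitions hd hd0,
    fun n p hp => ⟨redundancyValues_isLeast hd0 hp, fun j =>
      ⟨lowerBound_nonneg hd hd0 (hp.1 j).1 (hp.1 j).2, lowerBound_le_optRedundancy hd hd0 hp j,
        optRedundancy_lt_upperBound hd hd0 hp j,
        upperBound_le_one hd hd0 (hp.1 j).1 (hp.1 j).2⟩⟩,
    fun x hx0 hx1 => exists_optRedundancy_eq_lowerBound hd hd0 hx0 hx1,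
    fun x hx hx1 ε hε => exists_upperBound_sub_lt_optRedundancy hd hd0 hx hx1 hε,
    fun hneg n p hp j hj => optRedundancy_lt_max hd hneg hp hj⟩
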